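/- **Setting.** Let $G=(V,E)$ be a finite bipartite graph with edge probabilities $p_e\in(0,1]$, profits $w_e>0$ and node timeouts $t_v\in\{1,2,\dots\}$. A probing strategy adaptively probes edges one by one. A probed edge $e$ is present with probability $p_e$, independently of the others, and is then irrevocably taken, with profit $w_e$. No edge is probed twice, no edge sharing an endpoint with a taken edge is probed, and at most $t_v$ edges incident to $v$ are probed in total. $OPT$ is a strategy of maximum expected profit. Write $\delta(v)$ for the edges incident to $v$. LP-BIP is the linear program $$\max\sum_{e\in E} w_ep_ex_e\quad\text{s.t.}\quad \sum_{e\in\delta(v)}p_ex_e\le 1,\ \ \sum_{e\in\delta(v)}x_e\le t_v\ \ (v\in V),\qquad 0\le x_e\le 1\ \ (e\in E).$$ **Algorithm 1.** Take an optimal solution $x$ of LP-BIP and round it to a random set $\hat E\subseteq E$ by the dependent rounding procedure of Gandhi, Khuller, Parthasarathy and Srinivasan (GKPS): while some entry is fractional, pick a cycle of fractional edges, or a path of fractional edges whose two ends are incident to no further fractional edge; let $s$ be its alternating $\pm1$ vector and $a,b>0$ the largest numbers for which $x+as$ and $x-bs$ have entries in $[0,1]$ on this cycle or path; replace $x$ by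 $x+as$ with probability $\frac b{a+b}$ and by $x-bs$ with probability $\frac a{a+b}$. Finally $\hat E=\{e:x_e=1\}$. Independently draw $Y_e$ with density $e^{-p_ey}$ on $\left[0,\frac1{p_e}\ln\frac1{1-p_e}\right]$ (on $[0,\infty)$ if $p_e=1$), go through $\hat E$ in increasing order of $Y_e$, and probe $e$ if it is *safe*, i.e. if no taken edge shares an endpoint with $e$ when $e$ is considered. **Greedy algorithm.** Probe, in any order, the edges of a matching of maximum weight with respect to the weights $w_ep_e$. **Patched algorithm.** Let $$g(p)=\frac1{2+p}\left(1-\exp\left(-(2+p)\tfrac1p\ln\tfrac1{1-p}\right)\right)\ (0<p<1),\qquad g(1)=\tfrac13,$$ let $\delta=0.6022$, and let $\gamma$ be the fraction of the LP value $\sum_e w_ep_ex_e$ contributed by the edges with $p_e\ge\delta$. Run the greedy algorithm if $\gamma\delta\ge\frac\gamma3+(1-\gamma)g(\delta)$, and Algorithm 1 otherwise. **Theorem.** An optimal strategy $OPT$, an optimal solution of LP-BIP and a maximum weight matching exist, and the rounding of every optimal LP solution can be carried out. For all choices of the optimal LP solution, of the cycles and paths in the rounding, and of the maximum weight matching and the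 order of its edges: 1. the rounding makes at most $|E|$ iterations; 2. in Algorithm 1, for every edge $e$ with $\mathbb P[e\in\hat E]>0$, $\ \mathbb P[e\text{ is safe}\mid e\in\hat E]\ge g(p_e)$; 3. the patched algorithm always respects the rules, in particular the timeouts, and $$\mathbb E[\text{profit of the patched algorithm}]\ \ge\ \frac1{2.845}\,\mathbb E[OPT].$$ -/

import Mathlib

open MeasureTheory

namespace StochasticMatching

noncomputable section

/-- A decision tree for probing edges: finish, or probe an edge `e` and continue with one of two
strategies, depending on whether `e` turns out to be present or absent. -/
inductive Strategy (E : Type*) where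
  | done : Strategy E
  | probe (e : E) (present absent : Strategy E) : Strategy E

/-- Expectation of `F (set of edges taken at the end)` when the strategy is run starting with the
edges of `M` already taken; the edge `e` is present with probability `p e`, independently of all
other edges, and it is taken as soon as it is probed and found present. -/
def Strategy.expect {E : Type*} [DecidableEq E] (p : E → ℝ) :
    Strategy E → Finset E → (Finset E → ℝ) → ℝ
  | .done, M, F => F M
  | .probe e a b, M, F => p e * a.expect p (insert e M) F + (1 - p e) * b.expect p M F

section Graph

variable {V : Type*} [Fintype V] [DecidableEq V] {G : SimpleGraph V} [DecidableRel G.Adj]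

/-- The two edges have a common endpoint. -/
def Touch (e f : G.edgeSet) : Prop := ∃ v : V, v ∈ (e : Sym2 V) ∧ v ∈ (f : Sym2 V)

/-- No two different edges of `M` have a common endpoint. -/
def IsMatching (M : Finset G.edgeSet) : Prop := ∀ e ∈ M, ∀ f ∈ M, e ≠ f → ¬ Touch e f

/-- The edges of `S` that are incident to the node `v`. -/
def incident (S : Finset G.edgeSet) (v : V) : Finset G.edgeSet :=
  S.filter fun e => v ∈ (e : Sym2 V)

variable (G) in
/-- The data of the Stochastic Matching problem on the graph `G`. -/
structure Input where
  /-- existence probabilities -/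
  p : G.edgeSet → ℝ
  /-- profits -/
  w : G.edgeSet → ℝ
  /-- timeouts -/
  t : V → ℕ
  p_pos : ∀ e, 0 < p e
  p_le_one : ∀ e, p e ≤ 1
  w_pos : ∀ e, 0 < w e
  t_pos : ∀ v, 0 < t v

/-- The strategy, continued after the edges of `probed` have been probed and those of `taken` have
been taken, respects the rules: it probes no edge twice, it never probes an edge that has a common
endpoint with a taken edge, and at most `t v` edges incident to a node `v` are probed in total. -/
def Input.FeasibleFrom (I : Input G) :
    Strategy G.edgeSet → Finset G.edgeSet → Finset G.edgeSet → Prop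
  | .done, _, _ => True
  | .probe e a b, probed, taken =>
      e ∉ probed ∧ (∀ f ∈ taken, ¬ Touch e f) ∧
      (∀ v ∈ (e : Sym2 V), (incident probed v).card < I.t v) ∧
      I.FeasibleFrom a (insert e probed) (insert e taken) ∧
      I.FeasibleFrom b (insert e probed) taken

/-- An (adaptive) probing strategy that respects the rules of the problem. -/
def Input.Feasible (I : Input G) (S : Strategy G.edgeSet) : Prop := I.FeasibleFrom S ∅ ∅

/-- The expected profit of a strategy. -/
def Input.profit (I : Input G) (S : Strategy G.edgeSet) : ℝ :=
  S.expect I.p ∅ fun M => ∑ e ∈ M, I.w e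

/-- An optimal probing strategy. -/
def Input.IsOptimal (I : Input G) (S : Strategy G.edgeSet) : Prop :=
  I.Feasible S ∧ ∀ T, I.Feasible T → I.profit T ≤ I.profit S

/-! ### The linear program -/

/-- Feasible solutions of LP-BIP. -/
structure Input.LPFeasible (I : Input G) (x : G.edgeSet → ℝ) : Prop where
  matching : ∀ v, ∑ e ∈ incident Finset.univ v, I.p e * x e ≤ 1
  timeout : ∀ v, ∑ e ∈ incident Finset.univ v, x e ≤ I.t v
  nonneg : ∀ e, 0 ≤ x e
  le_one : ∀ e, x e ≤ 1

/-- The objective function of LP-BIP. -/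
def Input.lpValue (I : Input G) (x : G.edgeSet → ℝ) : ℝ := ∑ e, I.w e * I.p e * x e

/-- Optimal solutions of LP-BIP. -/
def Input.LPOptimal (I : Input G) (x : G.edgeSet → ℝ) : Prop :=
  I.LPFeasible x ∧ ∀ y, I.LPFeasible y → I.lpValue y ≤ I.lpValue x

/-! ### Dependent rounding -/

/-- The edge has a value strictly between `0` and `1`. -/
def Floating (x : G.edgeSet → ℝ) (e : G.edgeSet) : Prop := 0 < x e ∧ x e < 1

/-- The node is incident to exactly one floating edge. -/
def IsLeaf (x : G.edgeSet → ℝ) (v : V) : Prop :=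
  ∃! e : G.edgeSet, v ∈ (e : Sym2 V) ∧ Floating x e

/-- The alternating vector of a walk: `1, -1, 1, -1, …` on its consecutive edges, and `0` on all
other edges. -/
def alternating {u v : V} (c : G.Walk u v) (e : G.edgeSet) : ℝ :=
  if (e : Sym2 V) ∈ c.edges then (-1) ^ c.edges.idxOf (e : Sym2 V) else 0

/-- `s` is the alternating vector of a cycle of floating edges, or of a maximal path of floating
edges (a path whose two ends are incident to no further floating edge). -/
def IsDirection (x s : G.edgeSet → ℝ) : Prop :=
  (∃ (u : V) (c : G.Walk u u), c.IsCycle ∧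
    (∀ e : G.edgeSet, (e : Sym2 V) ∈ c.edges → Floating x e) ∧ s = alternating c) ∨
  (∃ (u v : V) (c : G.Walk u v), c.IsPath ∧ u ≠ v ∧
    (∀ e : G.edgeSet, (e : Sym2 V) ∈ c.edges → Floating x e) ∧
    IsLeaf x u ∧ IsLeaf x v ∧ s = alternating c)

/-- `a` is the largest `a > 0` for which `x + a • s` still has all entries of the support of `s`
in `[0, 1]`: at least one of these entries becomes `0` or `1`. -/
def IsStep (x s : G.edgeSet → ℝ) (a : ℝ) : Prop :=
  0 < a ∧ (∀ e, s e ≠ 0 → 0 ≤ x e + a * s e ∧ x e + a * s e ≤ 1) ∧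
    ∃ e, s e ≠ 0 ∧ (x e + a * s e = 0 ∨ x e + a * s e = 1)

/-- `DependentRounding n x μ`: some run of the dependent rounding procedure of Gandhi, Khuller,
Parthasarathy and Srinivasan on the fractional vector `x` makes at most `n` iterations, and `n`
on some branch, and returns a random set of edges which is equal to `S` with probability `μ S`.
While there are floating edges, the procedure picks a cycle or a maximal path of floating edges,
and moves `x` along its alternating vector `s`, to `x + a • s` with probability `b / (a + b)`
and to `x - b • s` with probability `a / (a + b)`, with `a` and `b` as large as possible. The
cycles and paths may be picked in any way, depending on the past. -/
inductive DependentRounding :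
    ℕ → (G.edgeSet → ℝ) → (Finset G.edgeSet → ℝ) → Prop
  | done (S : Finset G.edgeSet) :
      DependentRounding 0 (fun e => if e ∈ S then 1 else 0) (fun T => if T = S then 1 else 0)
  | iterate (n m : ℕ) (x s : G.edgeSet → ℝ) (a b : ℝ) (μ ν : Finset G.edgeSet → ℝ)
      (hs : IsDirection x s) (ha : IsStep x s a) (hb : IsStep x (fun e => - s e) b)
      (hμ : DependentRounding n (fun e => x e + a * s e) μ)
      (hν : DependentRounding m (fun e => x e - b * s e) ν) :
      DependentRounding (max n m + 1) x
        (fun T => b / (a + b) * μ T + a / (a + b) * ν T)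

/-! ### Probing in a random order -/

open scoped Classical in
/-- Go through the edges of a list; probe an edge if it has no common endpoint with the edges
taken so far (the set `M`), and skip it otherwise. -/
def probeList : List G.edgeSet → Finset G.edgeSet → Strategy G.edgeSet
  | [], _ => .done
  | e :: l, M =>
      if ∃ f ∈ M, Touch e f then probeList l M
      else .probe e (probeList l (insert e M)) (probeList l M)

/-- The edges of `S` in increasing order of the values `Y e`. -/
def sortedBy (Y : G.edgeSet → ℝ) (S : Finset G.edgeSet) : List G.edgeSet :=
  S.toList.insertionSort fun e f => Y e ≤ Y f

/-- The law of `Y e` for an edge of probability `q`: density `exp (-q y)` on the interval from `0`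
to `(1 / q) * log (1 / (1 - q))`, which is infinite for `q = 1`. The upper end of the interval is
written as `1 - q ≤ exp (-q y)`. -/
def orderLaw (q : ℝ) : Measure ℝ :=
  volume.withDensity fun y =>
    ENNReal.ofReal (if 0 ≤ y ∧ 1 - q ≤ Real.exp (-(q * y)) then Real.exp (-(q * y)) else 0)

/-- Expectation of `F Ê Y`, where the random set `Ê` is equal to `S` with probability `μ S`, and
the `Y e` are independent of each other and of `Ê`, and have the laws `orderLaw (p e)`. -/
def Input.mean (I : Input G) (μ : Finset G.edgeSet → ℝ)
    (F : Finset G.edgeSet → (G.edgeSet → ℝ) → ℝ) : ℝ :=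
  ∑ S, μ S * ∫ Y, F S Y ∂(Measure.pi fun e => orderLaw (I.p e))

open scoped Classical in
/-- Probability that the edge `e` is safe when the edges of `S` are considered in increasing order
of `Y`: when all edges of `S` before `e` have been processed, no taken edge has a common endpoint
with `e`. -/
def Input.safeProb (I : Input G) (S : Finset G.edgeSet) (Y : G.edgeSet → ℝ) (e : G.edgeSet) : ℝ :=
  (probeList ((sortedBy Y S).takeWhile fun f => decide (f ≠ e)) ∅).expect I.p ∅
    fun M => if ∃ f ∈ M, Touch e f then 0 else 1

/-- Probability that `e` belongs to the random set with distribution `μ`. -/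
def probMem (μ : Finset G.edgeSet → ℝ) (e : G.edgeSet) : ℝ := ∑ S, if e ∈ S then μ S else 0

/-- Conditional probability that `e` is safe, given that `e` belongs to the random set `Ê`. -/
def Input.condSafeProb (I : Input G) (μ : Finset G.edgeSet → ℝ) (e : G.edgeSet) : ℝ :=
  I.mean μ (fun S Y => if e ∈ S then I.safeProb S Y e else 0) / probMem μ e

/-- The function `(1 - exp (-(2 + q) * (1 / q) * log (1 / (1 - q)))) / (2 + q)` on `(0, 1)`,
with its limit `1 / 3` at `q = 1`. -/
def g (q : ℝ) : ℝ :=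
  if q = 1 then 1 / 3
  else 1 / (2 + q) * (1 - Real.exp (-((2 + q) * (1 / q * Real.log (1 / (1 - q))))))

/-! ### The patched algorithm -/

/-- `M` is a matching of maximum total weight with respect to the edge weights `w e * p e`. -/
def Input.IsMaxMatching (I : Input G) (M : Finset G.edgeSet) : Prop :=
  IsMatching M ∧ ∀ N : Finset G.edgeSet, IsMatching N →
    ∑ e ∈ N, I.w e * I.p e ≤ ∑ e ∈ M, I.w e * I.p e

/-- The threshold between small and large probabilities. -/
def threshold : ℝ := 0.6022

open scoped Classical in
/-- The fraction of the LP value of `x` that is due to the large edges. -/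
def Input.largeFraction (I : Input G) (x : G.edgeSet → ℝ) : ℝ :=
  (∑ e with threshold ≤ I.p e, I.w e * I.p e * x e) / I.lpValue x

open scoped Classical in
/-- The patched algorithm, with LP solution `x`, maximum weight matching listed as `L`, rounded set
of edges `S` and values `Y`: depending on `x` only, it either probes the edges of the list `L`, or
goes through the edges of `S` in increasing order of `Y`. -/
def Input.patched (I : Input G) (x : G.edgeSet → ℝ) (L : List G.edgeSet)
    (S : Finset G.edgeSet) (Y : G.edgeSet → ℝ) : Strategy G.edgeSet :=
  if I.largeFraction x / 3 + g threshold * (1 - I.largeFraction x)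
      ≤ I.largeFraction x * threshold then probeList L ∅
  else probeList (sortedBy Y S) ∅

end Graph

end

end StochasticMatching

/-!
The optimum of the linear program is an upper bound for every strategy, because the probabilities
with which a feasible strategy probes the edges are a feasible solution with the expected profit
as its value (`Input.Feasible.profit_le`). So it is enough to compare the patched algorithm with
the value of the LP solution `x`.

*Rounding.* The alternating sum of a walk around a node telescopes (`sum_alternating`). As cycles
of a bipartite graph are even, a direction leaves the fractional degree of a node unchanged unless
the node is a leaf, and moves any two edges at a node in opposite directions. By induction over the
iterations, the rounding preserves marginals (`DependentRounding.probMem_eq`), keeps integral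
degree bounds (`DependentRounding.card_incident_le`) and makes edges with a common endpoint
negatively correlated (`DependentRounding.sum_mem_mem_le`). Each iteration removes a floating edge.

*Random order.* If `Y e = y`, a conflicting edge `f` comes before `e` and is present with
probability at most `1 - exp (-(p f * y))`, which is what `orderLaw` is made for. So `e` is safe
with probability at least `E exp (-(c * Y e))`, where `c` is the sum of `p f` over the rounded edges `f`
in conflict with `e`. By negative correlation and the matching constraints at the two endpoints,
the conditional mean of `c` is at most `2`, and by convexity `e` is safe with probability at least
`E exp (-(2 * Y e)) = g (p e)` (`DependentRounding.mul_g_le_mean`).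

*Patching.* The function `g` is decreasing on `(0, 1]`, since the density of `orderLaw p` crosses
that of `orderLaw q` once when `p < q` (`g_anti`). Hence the first algorithm gets `γ / 3` from the
large edges and `(1 - γ) * g threshold` from the small ones. The greedy algorithm gets at least
`γ * threshold`: rounding the fractional matching `p e * x e` shows that it weighs at most as much
as a maximum matching (`Input.IsMaxMatching.sum_mul_le`). The larger one of the two bounds is at least
`1 / 2.845` for every `γ ≤ 1` (`inv_le_max_bound`).
-/

namespace StochasticMatching

set_option linter.unusedSectionVars false

/-! ### Strategies and the linear program -/

/-- The probability that the strategy probes a given edge (the expected number of times, for a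
strategy that may probe an edge twice). -/
def Strategy.probeProb {E : Type*} [DecidableEq E] (p : E → ℝ) : Strategy E → E → ℝ
  | .done, _ => 0
  | .probe e a b, f =>
      (if f = e then 1 else 0) + (p e * a.probeProb p f + (1 - p e) * b.probeProb p f)

theorem Strategy.expect_nonneg {E : Type*} [DecidableEq E] {p : E → ℝ} (h0 : ∀ e, 0 ≤ p e)
    (h1 : ∀ e, p e ≤ 1) {F : Finset E → ℝ} (hF : ∀ M, 0 ≤ F M) (S : Strategy E) (M : Finset E) :
    0 ≤ S.expect p M F := by
  induction S generalizing M with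
  | done => exact hF M
  | probe e a b iha ihb =>
    have := h1 e
    exact add_nonneg (mul_nonneg (h0 e) (iha _)) (mul_nonneg (by linarith) (ihb _))

section Graph

variable {V : Type*} [Fintype V] [DecidableEq V] {G : SimpleGraph V} [DecidableRel G.Adj]

theorem touch_self (e : G.edgeSet) : Touch e e := by
  obtain ⟨e, he⟩ := e
  induction e with
  | h u v => exact ⟨u, by simp, by simp⟩

theorem mem_incident {S : Finset G.edgeSet} {v : V} {e : G.edgeSet} :
    e ∈ incident S v ↔ e ∈ S ∧ v ∈ (e : Sym2 V) := by
  simp [incident]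

theorem incident_insert_of_mem {S : Finset G.edgeSet} {v : V} {e : G.edgeSet}
    (h : v ∈ (e : Sym2 V)) : incident (insert e S) v = insert e (incident S v) := by
  ext f
  simp only [mem_incident, Finset.mem_insert]
  grind

theorem incident_insert_of_notMem {S : Finset G.edgeSet} {v : V} {e : G.edgeSet}
    (h : v ∉ (e : Sym2 V)) : incident (insert e S) v = incident S v := by
  ext f
  simp only [mem_incident, Finset.mem_insert]
  grind

/-- Backward induction: from every state there is an optimal way to continue. -/
theorem Input.exists_optimal_from (I : Input G) (F : Finset G.edgeSet → ℝ)
    (P M : Finset G.edgeSet) :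
    ∃ S, I.FeasibleFrom S P M ∧
      ∀ T, I.FeasibleFrom T P M → T.expect I.p M F ≤ S.expect I.p M F := by
  induction hn : Pᶜ.card using Nat.strong_induction_on generalizing P M with
  | _ n ih =>
  subst hn
  have key : ∀ e ∉ P, ∀ M', ∃ S, I.FeasibleFrom S (insert e P) M' ∧
      ∀ T, I.FeasibleFrom T (insert e P) M' → T.expect I.p M' F ≤ S.expect I.p M' F := by
    intro e he M'
    refine ih _ ?_ _ M' rfl
    apply Finset.card_lt_card
    rw [Finset.compl_ssubset_compl]
    exact Finset.ssubset_insert he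
  have : Nonempty (Strategy G.edgeSet) := ⟨.done⟩
  choose! σ hσ hmax using key
  classical
  let A : Finset G.edgeSet := Finset.univ.filter fun e => e ∉ P ∧ (∀ f ∈ M, ¬ Touch e f) ∧
    ∀ v ∈ (e : Sym2 V), (incident P v).card < I.t v
  let cand : Option G.edgeSet → Strategy G.edgeSet := fun o =>
    o.elim .done fun e => .probe e (σ e (insert e M)) (σ e M)
  obtain ⟨o, ho, hbest⟩ := Finset.exists_max_image (Finset.insertNone A)
    (fun o => (cand o).expect I.p M F) ⟨none, by simp⟩
  refine ⟨cand o, ?_, fun T hT => ?_⟩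
  · cases o with
    | none => trivial
    | some e =>
      have he : e ∈ A := by simpa using ho
      simp only [A, Finset.mem_filter] at he
      exact ⟨he.2.1, he.2.2.1, he.2.2.2, hσ e he.2.1 _, hσ e he.2.1 _⟩
  · cases T with
    | done => exact hbest none (by simp)
    | probe e a b =>
      obtain ⟨h1, h2, h3, ha, hb⟩ := hT
      refine le_trans ?_ (hbest (some e)
        (Finset.some_mem_insertNone.2 (Finset.mem_filter.2 ⟨Finset.mem_univ _, h1, h2, h3⟩)))
      have hp := I.p_le_one e
      exact add_le_add (mul_le_mul_of_nonneg_left (hmax e h1 _ a ha) (I.p_pos e).le)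
        (mul_le_mul_of_nonneg_left (hmax e h1 _ b hb) (by linarith))

theorem Input.exists_isOptimal (I : Input G) : ∃ S, I.IsOptimal S :=
  I.exists_optimal_from _ ∅ ∅

theorem Strategy.probeProb_nonneg (I : Input G) (S : Strategy G.edgeSet) (f : G.edgeSet) :
    0 ≤ S.probeProb I.p f := by
  induction S with
  | done => exact le_rfl
  | probe e a b iha ihb =>
    have := I.p_le_one e
    have h1 := mul_nonneg (I.p_pos e).le iha
    have h2 := mul_nonneg (sub_nonneg.2 this) ihb
    simp only [Strategy.probeProb]
    split_ifs <;> linarith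

theorem Input.FeasibleFrom.probeProb_le (I : Input G) {S : Strategy G.edgeSet}
    {P M : Finset G.edgeSet} (h : I.FeasibleFrom S P M) (f : G.edgeSet) :
    S.probeProb I.p f ≤ if f ∈ P then 0 else 1 := by
  induction S generalizing P M with
  | done => simp only [Strategy.probeProb]; split_ifs <;> norm_num
  | probe e a b iha ihb =>
    obtain ⟨h1, -, -, ha, hb⟩ := h
    have h0 := I.p_pos e
    have h1' := I.p_le_one e
    have ha := iha ha
    have hb := ihb hb
    simp only [Strategy.probeProb]
    by_cases hf : f = e
    · subst hf
      simp only [Finset.mem_insert_self, if_true, h1, if_false] at ha hb ⊢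
      nlinarith
    · simp only [Finset.mem_insert, hf, false_or, if_false] at ha hb ⊢
      nlinarith

/-- Over a node which is not yet matched, at most one edge is taken. -/
theorem Input.FeasibleFrom.sum_p_mul_probeProb_le (I : Input G) {S : Strategy G.edgeSet}
    {P M : Finset G.edgeSet} (h : I.FeasibleFrom S P M) (v : V) :
    ∑ e ∈ incident Finset.univ v, I.p e * S.probeProb I.p e ≤
      if (incident M v).Nonempty then 0 else 1 := by
  induction S generalizing P M with
  | done => simp only [Strategy.probeProb, mul_zero, Finset.sum_const_zero]; split_ifs <;> norm_num
  | probe e a b iha ihb =>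
    obtain ⟨-, h2, -, ha, hb⟩ := h
    have h0 := I.p_pos e
    have h1' := I.p_le_one e
    have ha := iha ha
    have hb := ihb hb
    have hsum : ∑ f ∈ incident Finset.univ v,
          I.p f * (Strategy.probe e a b).probeProb I.p f =
        (if v ∈ (e : Sym2 V) then I.p e else 0) +
        (I.p e * ∑ f ∈ incident Finset.univ v, I.p f * a.probeProb I.p f +
        (1 - I.p e) * ∑ f ∈ incident Finset.univ v, I.p f * b.probeProb I.p f) := by
      simp only [Strategy.probeProb, mul_add, Finset.sum_add_distrib, Finset.mul_sum]
      congr 1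
      · simp [mem_incident]
      · congr 1 <;> exact Finset.sum_congr rfl fun _ _ => by ring
    rw [hsum]
    by_cases hv : v ∈ (e : Sym2 V)
    · have hM : ¬ (incident M v).Nonempty := by
        rintro ⟨f, hf⟩
        rw [mem_incident] at hf
        exact h2 f hf.1 ⟨v, hv, hf.2⟩
      simp only [hv, incident_insert_of_mem, Finset.insert_nonempty, if_true, hM, if_false] at *
      nlinarith
    · simp only [incident_insert_of_notMem hv, hv, if_false] at *
      nlinarith

/-- The rest of a strategy respects what is left of the timeouts. -/
theorem Input.FeasibleFrom.sum_probeProb_le (I : Input G) {S : Strategy G.edgeSet}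
    {P M : Finset G.edgeSet} (h : I.FeasibleFrom S P M) (v : V)
    (hP : (incident P v).card ≤ I.t v) :
    ∑ e ∈ incident Finset.univ v, S.probeProb I.p e ≤ I.t v - (incident P v).card := by
  induction S generalizing P M with
  | done =>
    have : ((incident P v).card : ℝ) ≤ I.t v := by exact_mod_cast hP
    simpa [Strategy.probeProb] using this
  | probe e a b iha ihb =>
    obtain ⟨h1, -, h3, ha, hb⟩ := h
    have h0 := I.p_pos e
    have h1' := I.p_le_one e
    have hsum : ∑ f ∈ incident Finset.univ v, (Strategy.probe e a b).probeProb I.p f =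
        (if v ∈ (e : Sym2 V) then 1 else 0) +
        (I.p e * ∑ f ∈ incident Finset.univ v, a.probeProb I.p f +
        (1 - I.p e) * ∑ f ∈ incident Finset.univ v, b.probeProb I.p f) := by
      simp only [Strategy.probeProb, Finset.sum_add_distrib, Finset.mul_sum]
      congr 1
      simp [mem_incident]
    rw [hsum]
    by_cases hv : v ∈ (e : Sym2 V)
    · have hc : (incident (insert e P) v).card = (incident P v).card + 1 := by
        rw [incident_insert_of_mem hv, Finset.card_insert_of_notMem]
        exact fun h => h1 (mem_incident.1 h).1
      have hlt := h3 v hv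
      have ha := iha ha (by omega)
      have hb := ihb hb (by omega)
      rw [hc] at ha hb
      push_cast at ha hb
      simp only [hv, if_true]
      nlinarith
    · have ha := iha ha (by rwa [incident_insert_of_notMem hv])
      have hb := ihb hb (by rwa [incident_insert_of_notMem hv])
      rw [incident_insert_of_notMem hv] at ha hb
      simp only [hv, if_false]
      nlinarith

theorem Input.FeasibleFrom.expect_sum_eq (I : Input G) {S : Strategy G.edgeSet}
    {P M : Finset G.edgeSet} (h : I.FeasibleFrom S P M) :
    S.expect I.p M (fun M => ∑ e ∈ M, I.w e) =
      ∑ e ∈ M, I.w e + ∑ e, I.w e * I.p e * S.probeProb I.p e := by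
  induction S generalizing P M with
  | done => simp [Strategy.expect, Strategy.probeProb]
  | probe e a b iha ihb =>
    obtain ⟨-, h2, -, ha, hb⟩ := h
    have he : e ∉ M := fun h => h2 e h (touch_self e)
    have hsum : ∑ f, I.w f * I.p f * (Strategy.probe e a b).probeProb I.p f =
        I.w e * I.p e + (I.p e * ∑ f, I.w f * I.p f * a.probeProb I.p f +
        (1 - I.p e) * ∑ f, I.w f * I.p f * b.probeProb I.p f) := by
      simp only [Strategy.probeProb, mul_add, Finset.sum_add_distrib, Finset.mul_sum]
      congr 1
      · simp
      · congr 1 <;> exact Finset.sum_congr rfl fun _ _ => by ring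
    rw [hsum, Strategy.expect, iha ha, ihb hb, Finset.sum_insert he]
    ring

/-- The probing probabilities of a feasible strategy are a feasible solution of the linear
program, so its optimum is an upper bound for the expected profit. -/
theorem Input.Feasible.profit_le (I : Input G) {S : Strategy G.edgeSet} (hS : I.Feasible S)
    {x : G.edgeSet → ℝ} (hx : I.LPOptimal x) : I.profit S ≤ I.lpValue x := by
  have h := hx.2 (S.probeProb I.p)
    { matching := fun v => by
        simpa [incident] using Input.FeasibleFrom.sum_p_mul_probeProb_le I hS v
      timeout := fun v => by
        simpa [incident] using Input.FeasibleFrom.sum_probeProb_le I hS v (by simp [incident])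
      nonneg := S.probeProb_nonneg I
      le_one := fun e => by simpa using Input.FeasibleFrom.probeProb_le I hS e }
  refine le_trans (le_of_eq ?_) h
  rw [Input.profit, Input.FeasibleFrom.expect_sum_eq I hS]
  simp [Input.lpValue]

theorem Input.exists_lpOptimal (I : Input G) : ∃ x, I.LPOptimal x := by
  have hset : {x | I.LPFeasible x} = Set.Icc 0 1 ∩
      ((⋂ v, {x | ∑ e ∈ incident Finset.univ v, I.p e * x e ≤ 1}) ∩
      ⋂ v, {x | ∑ e ∈ incident Finset.univ v, x e ≤ (I.t v : ℝ)}) := by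
    ext x
    simp only [Set.mem_ofPred_eq, Set.mem_inter_iff, Set.mem_Icc, Set.mem_iInter, Pi.le_def]
    exact ⟨fun h => ⟨⟨h.nonneg, h.le_one⟩, h.matching, h.timeout⟩,
      fun h => ⟨h.2.1, h.2.2, h.1.1, h.1.2⟩⟩
  have hcomp : IsCompact {x | I.LPFeasible x} := by
    rw [hset]
    refine isCompact_Icc.inter_right (IsClosed.inter ?_ ?_)
    · exact isClosed_iInter fun v => isClosed_le (by fun_prop) continuous_const
    · exact isClosed_iInter fun v => isClosed_le (by fun_prop) continuous_const
  have hne : {x | I.LPFeasible x}.Nonempty := by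
    refine ⟨0, ⟨fun v => ?_, fun v => ?_, fun e => le_rfl, fun e => ?_⟩⟩ <;> simp
  obtain ⟨x, hx, hmax⟩ := hcomp.exists_isMaxOn (f := I.lpValue) hne
    (by unfold Input.lpValue; fun_prop)
  exact ⟨x, hx, fun y hy => hmax hy⟩

theorem Input.exists_isMaxMatching (I : Input G) : ∃ M, I.IsMaxMatching M := by
  classical
  obtain ⟨M, hM, hmax⟩ := Finset.exists_max_image
    (Finset.univ.filter fun M : Finset G.edgeSet => IsMatching M)
    (fun M => ∑ e ∈ M, I.w e * I.p e) ⟨∅, by simp [IsMatching]⟩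
  exact ⟨M, (Finset.mem_filter.1 hM).2, fun N hN => hmax N (by simpa using hN)⟩

/-! ### Probing the edges of a list -/

theorem probeList_cons_of_touch {e : G.edgeSet} {l : List G.edgeSet} {M : Finset G.edgeSet}
    (h : ∃ f ∈ M, Touch e f) : probeList (e :: l) M = probeList l M := by
  rw [probeList, if_pos h]

theorem probeList_cons_of_not_touch {e : G.edgeSet} {l : List G.edgeSet} {M : Finset G.edgeSet}
    (h : ¬ ∃ f ∈ M, Touch e f) :
    probeList (e :: l) M = .probe e (probeList l (insert e M)) (probeList l M) := by
  rw [probeList, if_neg h]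

theorem Input.feasibleFrom_probeList (I : Input G) {l : List G.edgeSet} {P M : Finset G.edgeSet}
    (hl : l.Nodup) (hP : ∀ e ∈ l, e ∉ P)
    (ht : ∀ v, (incident P v).card + (incident l.toFinset v).card ≤ I.t v) :
    I.FeasibleFrom (probeList l M) P M := by
  induction l generalizing P M with
  | nil => trivial
  | cons e l ih =>
    rw [List.nodup_cons] at hl
    have hle : ∀ v, (incident l.toFinset v).card ≤ (incident (e :: l).toFinset v).card := fun v =>
      Finset.card_le_card (Finset.filter_subset_filter _ (by simp))
    have hstep : ∀ v ∈ (e : Sym2 V),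
        (incident (e :: l).toFinset v).card = (incident l.toFinset v).card + 1 := by
      intro v hv
      rw [List.toFinset_cons, incident_insert_of_mem hv, Finset.card_insert_of_notMem]
      simpa [mem_incident] using fun h => absurd h hl.1
    have hP' : ∀ f ∈ l, f ∉ insert e P := by
      intro f hf h
      rcases Finset.mem_insert.1 h with rfl | h
      · exact hl.1 hf
      · exact hP f (by simp [hf]) h
    have ht' : ∀ v, (incident (insert e P) v).card + (incident l.toFinset v).card ≤ I.t v := by
      intro v
      by_cases hv : v ∈ (e : Sym2 V)
      · rw [incident_insert_of_mem hv]
        have := Finset.card_insert_le e (incident P v)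
        have := hstep v hv
        have := ht v
        omega
      · rw [incident_insert_of_notMem hv]
        exact (Nat.add_le_add_left (hle v) _).trans (ht v)
    rw [probeList]
    split_ifs with h
    · exact ih hl.2 (fun f hf => hP f (by simp [hf]))
        fun v => (Nat.add_le_add_left (hle v) _).trans (ht v)
    · refine ⟨hP e (by simp), fun f hf ht => h ⟨f, hf, ht⟩, fun v hv => ?_,
        ih hl.2 hP' ht', ih hl.2 hP' ht'⟩
      have := hstep v hv
      have := ht v
      omega

theorem Input.feasible_probeList (I : Input G) {l : List G.edgeSet} (hl : l.Nodup)
    (ht : ∀ v, (incident l.toFinset v).card ≤ I.t v) : I.Feasible (probeList l ∅) :=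
  I.feasibleFrom_probeList hl (by simp) (by simpa [incident] using ht)

theorem IsMatching.card_incident_le_one {M : Finset G.edgeSet} (hM : IsMatching M) (v : V) :
    (incident M v).card ≤ 1 := by
  rw [Finset.card_le_one]
  intro e he f hf
  rw [mem_incident] at he hf
  by_contra hne
  exact hM e he.1 f hf.1 hne ⟨v, he.2, hf.2⟩

open scoped Classical in
/-- By linearity of expectation, an edge of the list contributes its profit times the probability
that it is present and not blocked by the edges before it. -/
theorem Input.expect_probeList_sum (I : Input G) {l : List G.edgeSet} (hl : l.Nodup)
    (M : Finset G.edgeSet) :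
    (probeList l M).expect I.p M (fun M => ∑ e ∈ M, I.w e) =
      ∑ e ∈ M, I.w e + ∑ e ∈ l.toFinset, I.w e * I.p e *
        (probeList (l.takeWhile fun f => decide (f ≠ e)) M).expect I.p M
          fun M => if ∃ f ∈ M, Touch e f then 0 else 1 := by
  induction l generalizing M with
  | nil => simp [probeList, Strategy.expect]
  | cons e l ih =>
    rw [List.nodup_cons] at hl
    have hne : ∀ f ∈ l.toFinset, e ≠ f := by
      rintro f hf rfl
      exact hl.1 (by simpa using hf)
    rw [List.toFinset_cons, Finset.sum_insert (by simpa using hl.1),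
      List.takeWhile_cons_of_neg (by simp)]
    have htail : ∀ f ∈ l.toFinset, (e :: l).takeWhile (fun g => decide (g ≠ f)) =
        e :: l.takeWhile fun g => decide (g ≠ f) := fun f hf =>
      List.takeWhile_cons_of_pos (by simpa using hne f hf)
    by_cases h : ∃ f ∈ M, Touch e f
    · rw [probeList_cons_of_touch h, ih hl.2]
      simp only [probeList, Strategy.expect, h, if_true, mul_zero, zero_add, add_right_inj]
      exact Finset.sum_congr rfl fun f hf => by rw [htail f hf, probeList_cons_of_touch h]
    · have he : e ∉ M := fun he => h ⟨e, he, touch_self e⟩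
      rw [probeList_cons_of_not_touch h, Strategy.expect, ih hl.2, ih hl.2, Finset.sum_insert he]
      have : ∑ f ∈ l.toFinset, I.w f * I.p f *
          (probeList ((e :: l).takeWhile fun g => decide (g ≠ f)) M).expect I.p M
            (fun M => if ∃ g ∈ M, Touch f g then 0 else 1) =
          I.p e * ∑ f ∈ l.toFinset, I.w f * I.p f *
            (probeList (l.takeWhile fun g => decide (g ≠ f)) (insert e M)).expect I.p (insert e M)
              (fun M => if ∃ g ∈ M, Touch f g then 0 else 1) +
          (1 - I.p e) * ∑ f ∈ l.toFinset, I.w f * I.p f *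
            (probeList (l.takeWhile fun g => decide (g ≠ f)) M).expect I.p M
              (fun M => if ∃ g ∈ M, Touch f g then 0 else 1) := by
        rw [Finset.mul_sum, Finset.mul_sum, ← Finset.sum_add_distrib]
        refine Finset.sum_congr rfl fun f hf => ?_
        rw [htail f hf, probeList_cons_of_not_touch h, Strategy.expect]
        ring
      rw [this]
      simp only [probeList, Strategy.expect]
      rw [if_neg h]
      ring

open scoped Classical in
/-- The edge `e` is certainly not blocked if all the edges of the list which touch it are absent. -/
theorem Input.prod_le_expect_probeList (I : Input G) (e : G.edgeSet) (l : List G.edgeSet)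
    (M : Finset G.edgeSet) (hM : ¬ ∃ f ∈ M, Touch e f) :
    (l.map fun f => if Touch e f then 1 - I.p f else 1).prod ≤
      (probeList l M).expect I.p M fun M => if ∃ f ∈ M, Touch e f then 0 else 1 := by
  have hfac : ∀ f, (if Touch e f then 1 - I.p f else 1) ∈ Set.Icc (0 : ℝ) 1 := by
    intro f
    have := I.p_pos f
    have := I.p_le_one f
    split_ifs <;> constructor <;> linarith
  induction l generalizing M with
  | nil => simp only [List.map_nil, List.prod_nil, probeList, Strategy.expect, if_neg hM, le_rfl]
  | cons f l ih =>
    have hprod : 0 ≤ (l.map fun f => if Touch e f then 1 - I.p f else 1).prod := by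
      apply List.prod_nonneg
      simp only [List.mem_map]
      rintro _ ⟨g, -, rfl⟩
      exact (hfac g).1
    have h0 := I.p_pos f
    have h1 := I.p_le_one f
    rw [List.map_cons, List.prod_cons, probeList]
    split_ifs with hf ht ht
    · have := ih M hM
      nlinarith
    · have hb := ih M hM
      have ha : 0 ≤ (probeList l (insert f M)).expect I.p (insert f M)
          fun M => if ∃ f ∈ M, Touch e f then 0 else 1 :=
        Strategy.expect_nonneg (fun e => (I.p_pos e).le) I.p_le_one
          (fun M => by split_ifs <;> norm_num) _ _
      rw [Strategy.expect]
      nlinarith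
    · simpa using ih M hM
    · have hb := ih M hM
      have ha := ih (insert f M) (by
        rintro ⟨g, hg, hgt⟩
        rcases Finset.mem_insert.1 hg with rfl | hg
        · contradiction
        · exact hM ⟨g, hg, hgt⟩)
      rw [Strategy.expect]
      nlinarith

/-- Every edge of a matching is probed, whatever the order. -/
theorem Input.sum_le_profit_probeList (I : Input G) {l : List G.edgeSet} (hl : l.Nodup)
    (hM : IsMatching l.toFinset) : ∑ e ∈ l.toFinset, I.w e * I.p e ≤ I.profit (probeList l ∅) := by
  classical
  rw [Input.profit, I.expect_probeList_sum hl, Finset.sum_empty, zero_add]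
  refine Finset.sum_le_sum fun e he => ?_
  refine le_mul_of_one_le_right (mul_pos (I.w_pos e) (I.p_pos e)).le ?_
  refine le_trans (le_of_eq ?_) (I.prod_le_expect_probeList e _ ∅ (by simp))
  symm
  apply List.prod_eq_one
  simp only [List.mem_map]
  rintro _ ⟨f, hf, rfl⟩
  have hfl : f ∈ l := (List.takeWhile_sublist _).subset hf
  have hfe : f ≠ e := by simpa using List.mem_takeWhile_imp hf
  exact if_neg (hM e he f (by simpa using hfl) hfe.symm)

/-! ### Alternating vectors of walks -/

theorem sum_incident_eq_ite (v : V) {a b : V} (h : G.Adj a b) :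
    ∑ e ∈ incident (Finset.univ : Finset G.edgeSet) v,
      (if (e : Sym2 V) = s(a, b) then (1 : ℝ) else 0) =
      (if v = a then 1 else 0) + (if v = b then 1 else 0) := by
  have : ∀ e : G.edgeSet, (e : Sym2 V) = s(a, b) ↔ e = ⟨s(a, b), h⟩ := fun e => by
    rw [Subtype.ext_iff]
  simp only [this, Finset.sum_ite_eq', mem_incident, Finset.mem_univ, true_and, Sym2.mem_iff]
  have := h.ne
  by_cases h1 : v = a <;> by_cases h2 : v = b <;> simp_all

theorem alternating_ne_zero {u w : V} {c : G.Walk u w} {e : G.edgeSet} :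
    alternating c e ≠ 0 ↔ (e : Sym2 V) ∈ c.edges := by
  unfold alternating
  split_ifs with h <;> simp [h]

theorem alternating_sq_eq {u w : V} (c : G.Walk u w) (e : G.edgeSet) :
    alternating c e ^ 2 = 0 ∨ alternating c e ^ 2 = 1 := by
  unfold alternating
  split_ifs with h
  · right
    rw [← pow_mul, mul_comm, pow_mul]
    simp
  · simp

theorem alternating_cons {a b w : V} (h : G.Adj a b) (c : G.Walk b w) (e : G.edgeSet)
    (hc : s(a, b) ∉ c.edges) :
    alternating (.cons h c) e = (if (e : Sym2 V) = s(a, b) then 1 else 0) - alternating c e := by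
  unfold alternating
  rw [SimpleGraph.Walk.edges_cons]
  by_cases he : (e : Sym2 V) = s(a, b)
  · simp [he, hc]
  · by_cases hec : (e : Sym2 V) ∈ c.edges
    · simp [he, hec, List.idxOf_cons_ne _ (Ne.symm he), pow_succ]
    · simp [he, hec]

/-- The alternating sum around a node telescopes: only the two ends of the walk contribute. -/
theorem sum_alternating {u w : V} {c : G.Walk u w} (hc : c.IsTrail) (v : V) :
    ∑ e ∈ incident Finset.univ v, alternating c e =
      (if v = u then 1 else 0) - (-1) ^ c.length * (if v = w then 1 else 0) := by
  induction c with
  | nil => simp [alternating]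
  | cons h c ih =>
    rw [SimpleGraph.Walk.isTrail_cons] at hc
    simp only [alternating_cons h c _ hc.2, Finset.sum_sub_distrib, ih hc.1,
      sum_incident_eq_ite v h, SimpleGraph.Walk.length_cons, pow_succ]
    ring

/-- The number of edges of the walk at a node: two for each visit, except at the ends. -/
theorem sum_alternating_sq {u w : V} {c : G.Walk u w} (hc : c.IsTrail) (v : V) :
    ∑ e ∈ incident Finset.univ v, alternating c e ^ 2 =
      2 * c.support.count v - (if v = u then 1 else 0) - (if v = w then 1 else 0) := by
  induction c with
  | @nil u => by_cases h : v = u <;> simp [alternating, h, Ne.symm]; grind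
  | @cons a b w h c ih =>
    rw [SimpleGraph.Walk.isTrail_cons] at hc
    have hsq : ∀ e : G.edgeSet, alternating (.cons h c) e ^ 2 =
        (if (e : Sym2 V) = s(a, b) then 1 else 0) + alternating c e ^ 2 := by
      intro e
      rw [alternating_cons h c e hc.2]
      split_ifs with he
      · have : alternating c e = 0 := by
          by_contra h0
          exact hc.2 (he ▸ alternating_ne_zero.1 h0)
        rw [this]; norm_num
      · ring
    simp only [hsq, Finset.sum_add_distrib, ih hc.1, sum_incident_eq_ite v h,
      SimpleGraph.Walk.support_cons, List.count_cons, Nat.cast_add]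
    by_cases hv : v = a
    · subst hv; simp; ring
    · simp [hv, Ne.symm hv]; ring

/-! ### Directions of the dependent rounding -/

theorem IsDirection.floating {x s : G.edgeSet → ℝ} (h : IsDirection x s) {e : G.edgeSet}
    (he : s e ≠ 0) : Floating x e := by
  rcases h with ⟨u, c, -, hf, rfl⟩ | ⟨u, v, c, -, -, hf, -, -, rfl⟩ <;>
  exact hf e (alternating_ne_zero.1 he)

theorem IsDirection.sq_eq {x s : G.edgeSet → ℝ} (h : IsDirection x s) (e : G.edgeSet) :
    s e ^ 2 = 0 ∨ s e ^ 2 = 1 := by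
  rcases h with ⟨u, c, -, hf, rfl⟩ | ⟨u, v, c, -, -, hf, -, -, rfl⟩ <;>
  exact alternating_sq_eq c e

/-- A direction changes the fractional degree only at a leaf. For cycles this holds because they
are of even length. -/
theorem IsDirection.sum_eq_zero_or_isLeaf (hG : G.IsBipartite) {x s : G.edgeSet → ℝ}
    (h : IsDirection x s) (v : V) : ∑ e ∈ incident Finset.univ v, s e = 0 ∨ IsLeaf x v := by
  rcases h with ⟨u, c, hc, hf, rfl⟩ | ⟨u, w, c, hc, -, hf, hu, hw, rfl⟩
  · left
    obtain ⟨col⟩ := hG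
    have heven : Even c.length :=
      ((G.recolorOfEquiv finTwoEquiv col).even_length_iff_congr c).2 Iff.rfl
    rw [sum_alternating hc.isTrail, heven.neg_one_pow]
    ring
  · by_cases h1 : v = u
    · exact .inr (h1 ▸ hu)
    by_cases h2 : v = w
    · exact .inr (h2 ▸ hw)
    left
    simp [sum_alternating hc.isTrail, h1, h2]

theorem IsDirection.sum_sq_le {x s : G.edgeSet → ℝ} (h : IsDirection x s) (v : V) :
    ∑ e ∈ incident Finset.univ v, s e ^ 2 ≤ 2 := by
  rcases h with ⟨u, c, hc, hf, rfl⟩ | ⟨u, w, c, hc, -, hf, hu, hw, rfl⟩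
  · rw [sum_alternating_sq hc.isTrail]
    have hcount : c.support.count v = c.support.tail.count v + if v = u then 1 else 0 := by
      rw [← SimpleGraph.Walk.cons_tail_support c, List.count_cons]
      by_cases hv : v = u
      · subst hv; simp
      · simp [hv, Ne.symm hv]
    have : c.support.tail.count v ≤ 1 := List.nodup_iff_count_le_one.1 hc.support_nodup v
    have : (c.support.tail.count v : ℝ) ≤ 1 := by exact_mod_cast this
    rw [hcount]
    push_cast
    split_ifs <;> linarith
  · rw [sum_alternating_sq hc.isTrail]
    have : c.support.count v ≤ 1 := List.nodup_iff_count_le_one.1 hc.support_nodup v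
    have : (c.support.count v : ℝ) ≤ 1 := by exact_mod_cast this
    split_ifs <;> linarith

/-- Two edges at a common node never move in the same direction. -/
theorem IsDirection.mul_nonpos (hG : G.IsBipartite) {x s : G.edgeSet → ℝ} (h : IsDirection x s)
    {e f : G.edgeSet} (hef : e ≠ f) (ht : Touch e f) : s e * s f ≤ 0 := by
  obtain ⟨v, he, hf⟩ := ht
  by_contra! hpos
  have he0 : s e ≠ 0 := fun h0 => by simp [h0] at hpos
  have hf0 : s f ≠ 0 := fun h0 => by simp [h0] at hpos
  have hei : e ∈ incident Finset.univ v := mem_incident.2 ⟨Finset.mem_univ _, he⟩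
  have hfi : f ∈ (incident Finset.univ v).erase e :=
    Finset.mem_erase.2 ⟨hef.symm, mem_incident.2 ⟨Finset.mem_univ _, hf⟩⟩
  have hsq := h.sum_sq_le v
  rw [← Finset.add_sum_erase _ _ hei, ← Finset.add_sum_erase _ _ hfi,
    (h.sq_eq e).resolve_left (by positivity), (h.sq_eq f).resolve_left (by positivity)] at hsq
  have hrest : ∀ i ∈ ((incident Finset.univ v).erase e).erase f, s i ^ 2 = 0 :=
    (Finset.sum_eq_zero_iff_of_nonneg fun i _ => sq_nonneg (s i)).1
      (le_antisymm (by linarith) (Finset.sum_nonneg fun i _ => sq_nonneg (s i)))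
  rcases h.sum_eq_zero_or_isLeaf hG v with h0 | hl
  · rw [← Finset.add_sum_erase _ _ hei, ← Finset.add_sum_erase _ _ hfi,
      Finset.sum_eq_zero fun i hi => pow_eq_zero_iff two_ne_zero |>.1 (hrest i hi)] at h0
    have : s f = - s e := by linarith
    rw [this] at hpos
    nlinarith [sq_nonneg (s e)]
  · exact hef (hl.unique ⟨he, h.floating he0⟩ ⟨hf, h.floating hf0⟩)

/-- The graph of the floating edges contains a cycle, or else the two ends of one of its longest
paths are leaves. -/
theorem exists_isDirection {x : G.edgeSet → ℝ} (hx : ∃ e, Floating x e) :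
    ∃ s, IsDirection x s ∧ ∃ e, s e ≠ 0 := by
  let H : SimpleGraph V :=
    SimpleGraph.fromEdgeSet {e | ∃ h : e ∈ G.edgeSet, Floating x ⟨e, h⟩}
  have hadj : ∀ {a b}, H.Adj a b ↔ ∃ h : s(a, b) ∈ G.edgeSet, Floating x ⟨s(a, b), h⟩ := by
    intro a b
    simp only [H, SimpleGraph.fromEdgeSet_adj]
    exact ⟨fun h => h.1, fun h => ⟨h, G.ne_of_adj h.1⟩⟩
  have hle : H ≤ G := fun a b h => (hadj.1 h).1
  have hfl : ∀ {a b} (c : H.Walk a b) (e : G.edgeSet), (e : Sym2 V) ∈ (c.mapLe hle).edges →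
      Floating x e := by
    intro a b c ⟨e, heG⟩ he
    rw [SimpleGraph.Walk.edges_mapLe_eq_edges] at he
    have := c.edges_subset_edgeSet he
    induction e with
    | h p q => exact (hadj.1 this).2
  have hsupp : ∀ {a b} (c : H.Walk a b), ¬ c.Nil → ∃ e, alternating (c.mapLe hle) e ≠ 0 := by
    intro a b c hc
    have hne : (c.mapLe hle).edges ≠ [] := by
      rw [SimpleGraph.Walk.edges_mapLe_eq_edges]
      simpa [SimpleGraph.Walk.edges_eq_nil] using hc
    obtain ⟨e, he⟩ := List.exists_mem_of_ne_nil _ hne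
    exact ⟨⟨e, (c.mapLe hle).edges_subset_edgeSet he⟩, alternating_ne_zero.2 he⟩
  by_cases hac : H.IsAcyclic
  · obtain ⟨⟨e, heG⟩, he⟩ := hx
    induction e with
    | h p q =>
    have hpq : H.Adj p q := hadj.2 ⟨heG, he⟩
    have : Nonempty V := ⟨p⟩
    classical
    obtain ⟨u, v, c, hc, hmax⟩ := SimpleGraph.Walk.exists_isPath_forall_isPath_length_le_length H
    have hnil : ¬ c.Nil := by
      intro hn
      have := hmax p q (.cons hpq .nil) (by simp [hpq.ne])
      rw [SimpleGraph.Walk.length_cons, SimpleGraph.Walk.length_eq_zero_iff.2 hn] at this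
      omega
    have hleaf : ∀ {a b}, H.Adj a b → (∀ w, H.Adj a w → w = b) → IsLeaf x a := by
      intro a b hab huniq
      refine ⟨⟨s(a, b), (hadj.1 hab).1⟩, ⟨by simp, (hadj.1 hab).2⟩, ?_⟩
      rintro ⟨f, hfG⟩ ⟨haf, hf⟩
      obtain ⟨w, rfl⟩ := haf
      rw [Subtype.mk.injEq, huniq w (hadj.2 ⟨hfG, hf⟩)]
    refine ⟨_, .inr ⟨u, v, c.mapLe hle, hc.mapLe hle, hc.nil_iff_eq.not.1 hnil, hfl c,
      hleaf (c.adj_snd hnil) fun w hw => ?_, hleaf (c.adj_penultimate hnil).symm fun w hw => ?_,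
      rfl⟩, hsupp c hnil⟩
    · apply hac.eq_snd_of_adj_start hc hw
      have : ¬ (c.cons hw.symm).IsPath := fun h => by
        have := hmax _ _ _ h
        simp at this
      grind [hc.cons]
    · apply hac.eq_penultimate_of_adj_end hc hw
      have : ¬ (c.concat hw).IsPath := fun h => by
        have := hmax _ _ _ h
        simp at this
      grind [hc.concat]
  · unfold SimpleGraph.IsAcyclic at hac
    push Not at hac
    obtain ⟨u, c, hc⟩ := hac
    exact ⟨_, .inl ⟨u, c.mapLe hle, hc.mapLe hle, hfl c, rfl⟩, hsupp c hc.not_nil⟩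

/-! ### Steps of the dependent rounding -/

/-- The step length is the smallest distance to the boundary over the entries in the support. -/
theorem exists_isStep {x s : G.edgeSet → ℝ} (hs : ∀ e, s e ≠ 0 → Floating x e)
    (hne : ∃ e, s e ≠ 0) : ∃ a, IsStep x s a := by
  classical
  let r : G.edgeSet → ℝ := fun e => if 0 < s e then (1 - x e) / s e else x e / -s e
  obtain ⟨e, he⟩ := hne
  obtain ⟨m, hm, hmin⟩ := Finset.exists_min_image (Finset.univ.filter fun e => s e ≠ 0) r
    ⟨e, by simpa using he⟩
  have hpos : ∀ e, s e ≠ 0 → 0 < r e := by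
    intro e he
    have := hs e he
    simp only [r]
    split_ifs with h
    · exact div_pos (by linarith [this.2]) h
    · exact div_pos this.1 (neg_pos.2 (lt_of_le_of_ne (not_lt.1 h) he))
  simp only [Finset.mem_filter, Finset.mem_univ, true_and] at hm hmin
  have hm0 := hpos m hm
  refine ⟨r m, hm0, fun e he => ?_, m, hm, ?_⟩
  · have hr := hmin e he
    have hf := hs e he
    by_cases h : 0 < s e
    · have : r e * s e = 1 - x e := by simp only [r, if_pos h]; field_simp
      have := mul_le_mul_of_nonneg_right hr h.le
      have := mul_pos hm0 h
      constructor <;> linarith [hf.1, hf.2]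
    · have hneg : s e < 0 := lt_of_le_of_ne (not_lt.1 h) he
      have : r e * s e = - x e := by simp only [r, if_neg h]; field_simp
      have := mul_le_mul_of_nonpos_right hr hneg.le
      have := mul_neg_of_pos_of_neg hm0 hneg
      constructor <;> linarith [hf.1, hf.2]
  · by_cases h : 0 < s m
    · right
      simp only [r, if_pos h]; field_simp; ring
    · left
      simp only [r, if_neg h]; field_simp; ring

theorem IsStep.mem_Icc {x s : G.edgeSet → ℝ} {a : ℝ} (h : IsStep x s a)
    (hx : ∀ e, x e ∈ Set.Icc (0 : ℝ) 1) (e : G.edgeSet) : x e + a * s e ∈ Set.Icc (0 : ℝ) 1 := by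
  by_cases he : s e = 0
  · simpa [he] using hx e
  · exact h.2.1 e he

open scoped Classical in
/-- The floating edges of a fractional vector. -/
noncomputable def floatingEdges (x : G.edgeSet → ℝ) : Finset G.edgeSet :=
  Finset.univ.filter (Floating x)

theorem mem_floatingEdges {x : G.edgeSet → ℝ} {e : G.edgeSet} :
    e ∈ floatingEdges x ↔ Floating x e := by
  simp [floatingEdges]

theorem IsStep.card_floatingEdges_lt {x s : G.edgeSet → ℝ} {a : ℝ} (h : IsStep x s a)
    (hs : ∀ e, s e ≠ 0 → Floating x e) :
    (floatingEdges fun e => x e + a * s e).card < (floatingEdges x).card := by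
  apply Finset.card_lt_card
  obtain ⟨-, -, m, hm, hmx⟩ := h
  rw [Finset.ssubset_iff_of_subset]
  · refine ⟨m, mem_floatingEdges.2 (hs m hm), fun hf => ?_⟩
    rw [mem_floatingEdges] at hf
    rcases hmx with h0 | h1
    · exact hf.1.ne' h0
    · exact hf.2.ne h1
  · intro e he
    rw [mem_floatingEdges] at he ⊢
    by_cases hse : s e = 0
    · simpa [Floating, hse] using he
    · exact hs e hse

theorem sub_mul_eq_add_mul_neg {x s : G.edgeSet → ℝ} {b : ℝ} :
    (fun e => x e - b * s e) = fun e => x e + b * (- s e) := by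
  funext e; ring

/-! ### Properties of the dependent rounding -/

theorem exists_dependentRounding {x : G.edgeSet → ℝ} (hx : ∀ e, x e ∈ Set.Icc (0 : ℝ) 1) :
    ∃ n μ, DependentRounding n x μ := by
  induction hn : (floatingEdges x).card using Nat.strong_induction_on generalizing x with
  | _ n ih =>
  subst hn
  by_cases hf : ∃ e, Floating x e
  · obtain ⟨s, hs, hne⟩ := exists_isDirection hf
    obtain ⟨a, ha⟩ := exists_isStep (fun e => hs.floating) hne
    have hs' : ∀ e, -s e ≠ 0 → Floating x e := fun e he => hs.floating (by simpa using he)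
    obtain ⟨b, hb⟩ := exists_isStep hs' (by simpa using hne)
    obtain ⟨n, μ, hμ⟩ := ih _ (ha.card_floatingEdges_lt fun e => hs.floating) (ha.mem_Icc hx) rfl
    obtain ⟨m, ν, hν⟩ := ih _ (hb.card_floatingEdges_lt hs') (hb.mem_Icc hx) rfl
    rw [← sub_mul_eq_add_mul_neg] at hν
    exact ⟨_, _, .iterate n m x s a b μ ν hs ha hb hμ hν⟩
  · classical
    have : x = fun e => if e ∈ Finset.univ.filter (fun e => x e = 1) then 1 else 0 := by
      funext e
      simp only [Finset.mem_filter, Finset.mem_univ, true_and]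
      split_ifs with h1
      · exact h1
      · by_contra h0
        exact hf ⟨e, lt_of_le_of_ne (hx e).1 (Ne.symm h0), lt_of_le_of_ne (hx e).2 h1⟩
    rw [this]
    exact ⟨_, _, .done _⟩

/-- Every iteration removes a floating edge. -/
theorem DependentRounding.le_card {n : ℕ} {x : G.edgeSet → ℝ} {μ : Finset G.edgeSet → ℝ}
    (h : DependentRounding n x μ) : n ≤ (floatingEdges x).card := by
  induction h with
  | done S => exact Nat.zero_le _
  | iterate n m x s a b μ ν hs ha hb _ _ ihμ ihν =>
    have h1 := ha.card_floatingEdges_lt fun e => hs.floating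
    have h2 := hb.card_floatingEdges_lt fun e he => hs.floating (by simpa using he)
    rw [sub_mul_eq_add_mul_neg] at ihν
    omega

theorem DependentRounding.nonneg {n : ℕ} {x : G.edgeSet → ℝ} {μ : Finset G.edgeSet → ℝ}
    (h : DependentRounding n x μ) (S : Finset G.edgeSet) : 0 ≤ μ S := by
  induction h with
  | done T => dsimp only; split_ifs <;> norm_num
  | iterate n m x s a b μ ν hs ha hb _ _ ihμ ihν =>
    have := ha.1
    have := hb.1
    positivity

theorem DependentRounding.sum_eq_one {n : ℕ} {x : G.edgeSet → ℝ} {μ : Finset G.edgeSet → ℝ}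
    (h : DependentRounding n x μ) : ∑ S, μ S = 1 := by
  induction h with
  | done T => simp
  | iterate n m x s a b μ ν hs ha hb _ _ ihμ ihν =>
    have := ha.1
    have := hb.1
    rw [Finset.sum_add_distrib, ← Finset.mul_sum, ← Finset.mul_sum, ihμ, ihν]
    field_simp
    ring

theorem DependentRounding.sum_mem {n : ℕ} {x : G.edgeSet → ℝ} {μ : Finset G.edgeSet → ℝ}
    (h : DependentRounding n x μ) (e : G.edgeSet) :
    ∑ S, μ S * (if e ∈ S then 1 else 0) = x e := by
  induction h with
  | done T => simp only [ite_mul, one_mul, zero_mul, Finset.sum_ite_eq', Finset.mem_univ, if_true]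
  | iterate n m x s a b μ ν hs ha hb _ _ ihμ ihν =>
    have := ha.1
    have := hb.1
    simp only [add_mul, mul_assoc, Finset.sum_add_distrib, ← Finset.mul_sum, ihμ, ihν]
    field_simp
    ring

/-- Dependent rounding preserves the marginal probabilities. -/
theorem DependentRounding.probMem_eq {n : ℕ} {x : G.edgeSet → ℝ} {μ : Finset G.edgeSet → ℝ}
    (h : DependentRounding n x μ) (e : G.edgeSet) : probMem μ e = x e := by
  rw [← h.sum_mem e]
  simp [probMem]

/-- Two edges at a common node are negatively correlated. -/
theorem DependentRounding.sum_mem_mem_le (hG : G.IsBipartite) {n : ℕ} {x : G.edgeSet → ℝ}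
    {μ : Finset G.edgeSet → ℝ} (h : DependentRounding n x μ) {e f : G.edgeSet} (hef : e ≠ f)
    (ht : Touch e f) :
    ∑ S, μ S * ((if e ∈ S then 1 else 0) * (if f ∈ S then 1 else 0)) ≤ x e * x f := by
  induction h with
  | done T =>
    simp only [ite_mul, one_mul, zero_mul, Finset.sum_ite_eq', Finset.mem_univ, if_true, le_rfl]
  | iterate n m x s a b μ ν hs ha hb _ _ ihμ ihν =>
    have ha := ha.1
    have hb := hb.1
    have hsef := hs.mul_nonpos hG hef ht
    simp only [add_mul, mul_assoc (_ / _), Finset.sum_add_distrib, ← Finset.mul_sum]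
    calc _ ≤ b / (a + b) * ((x e + a * s e) * (x f + a * s f)) +
          a / (a + b) * ((x e - b * s e) * (x f - b * s f)) := by gcongr
      _ = x e * x f + a * b * (s e * s f) := by field_simp; ring
      _ ≤ x e * x f := by
        have := mul_nonneg (mul_pos ha hb).le (neg_nonneg.2 hsef)
        linarith

/-- A fractional degree of at most `k` stays at most `k`: at a leaf, the only floating edge takes
the place of a positive fraction. -/
theorem IsDirection.sum_step_le (hG : G.IsBipartite) {x s : G.edgeSet → ℝ} (hs : IsDirection x s)
    (hx : ∀ e, x e ∈ Set.Icc (0 : ℝ) 1) {a : ℝ} (hxa : ∀ e, x e + a * s e ∈ Set.Icc (0 : ℝ) 1)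
    {v : V} {k : ℕ} (hk : ∑ e ∈ incident Finset.univ v, x e ≤ k) :
    ∑ e ∈ incident Finset.univ v, (x e + a * s e) ≤ k := by
  rcases hs.sum_eq_zero_or_isLeaf hG v with h0 | ⟨e, ⟨hev, he⟩, huniq⟩
  · rwa [Finset.sum_add_distrib, ← Finset.mul_sum, h0, mul_zero, add_zero]
  · have hei : e ∈ incident Finset.univ v := mem_incident.2 ⟨Finset.mem_univ _, hev⟩
    have hnf : ∀ f ∈ (incident Finset.univ v).erase e, ¬ Floating x f := by
      intro f hf hfl
      rw [Finset.mem_erase, mem_incident] at hf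
      exact hf.1 (huniq f ⟨hf.2.2, hfl⟩)
    have hrest : ∑ f ∈ (incident Finset.univ v).erase e, (x f + a * s f) =
        ∑ f ∈ (incident Finset.univ v).erase e, x f := by
      refine Finset.sum_congr rfl fun f hf => ?_
      have : s f = 0 := by
        by_contra h
        exact hnf f hf (hs.floating h)
      simp [this]
    obtain ⟨m, hm⟩ : ∃ m : ℕ, ∑ f ∈ (incident Finset.univ v).erase e, x f = m := by
      classical
      refine ⟨(((incident Finset.univ v).erase e).filter fun f => x f = 1).card, ?_⟩
      rw [Finset.card_filter, Nat.cast_sum]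
      refine Finset.sum_congr rfl fun f hf => ?_
      split_ifs with h1
      · simp [h1]
      · by_contra h0
        exact hnf f hf ⟨lt_of_le_of_ne (hx f).1 (by simpa [eq_comm] using h0),
          lt_of_le_of_ne (hx f).2 h1⟩
    rw [← Finset.add_sum_erase _ _ hei, hm] at hk
    rw [← Finset.add_sum_erase _ _ hei, hrest, hm]
    have hmk : m < k := by
      have : (m : ℝ) < k := by linarith [he.1]
      exact_mod_cast this
    have : (m : ℝ) + 1 ≤ k := by exact_mod_cast hmk
    linarith [(hxa e).2]

/-- Degree preservation: every possible outcome satisfies the integral degree bounds of `x`. -/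
theorem DependentRounding.card_incident_le (hG : G.IsBipartite) {n : ℕ} {x : G.edgeSet → ℝ}
    {μ : Finset G.edgeSet → ℝ} (h : DependentRounding n x μ)
    (hx : ∀ e, x e ∈ Set.Icc (0 : ℝ) 1) {v : V} {k : ℕ}
    (hk : ∑ e ∈ incident Finset.univ v, x e ≤ k) {S : Finset G.edgeSet} (hS : 0 < μ S) :
    (incident S v).card ≤ k := by
  induction h with
  | done T =>
    obtain rfl : S = T := by
      by_contra hne
      simp [hne] at hS
    rw [← Nat.cast_le (α := ℝ)]
    refine le_trans (le_of_eq ?_) hk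
    rw [Finset.sum_ite_mem, Finset.sum_const, nsmul_eq_mul, mul_one]
    congr 2
    ext e
    simp [mem_incident, and_comm]
  | iterate n m x s a b μ ν hs ha hb _ _ ihμ ihν =>
    rw [sub_mul_eq_add_mul_neg] at ihν
    have hxb := hb.mem_Icc hx
    have hxa := ha.mem_Icc hx
    have ha := ha.1
    have hb := hb.1
    by_cases hμS : 0 < μ S
    · exact ihμ hxa (hs.sum_step_le hG hx hxa hk) hμS
    · have hνS : 0 < ν S := by
        by_contra hνS
        have h1 := mul_nonpos_of_nonneg_of_nonpos (by positivity : 0 ≤ b / (a + b)) (not_lt.1 hμS)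
        have h2 := mul_nonpos_of_nonneg_of_nonpos (by positivity : 0 ≤ a / (a + b)) (not_lt.1 hνS)
        linarith
      refine ihν hxb ?_ hνS
      have : ∀ e, x e + b * -s e = x e + (-b) * s e := fun e => by ring
      simp only [this] at hxb ⊢
      exact hs.sum_step_le hG hx hxb hk

/-- The bipartite matching polytope is integral: a fractional matching `y` has at most the weight
of a maximum matching, because rounding it produces matchings with marginals `y`. -/
theorem Input.IsMaxMatching.sum_mul_le (hG : G.IsBipartite) {I : Input G} {M : Finset G.edgeSet}
    (hM : I.IsMaxMatching M) {y : G.edgeSet → ℝ} (hy : ∀ e, y e ∈ Set.Icc (0 : ℝ) 1)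
    (hdeg : ∀ v, ∑ e ∈ incident Finset.univ v, y e ≤ 1) :
    ∑ e, I.w e * I.p e * y e ≤ ∑ e ∈ M, I.w e * I.p e := by
  obtain ⟨n, μ, h⟩ := exists_dependentRounding hy
  calc ∑ e, I.w e * I.p e * y e = ∑ S, μ S * ∑ e ∈ S, I.w e * I.p e := by
        simp only [← h.sum_mem, Finset.mul_sum]
        rw [Finset.sum_comm]
        refine Finset.sum_congr rfl fun S _ => ?_
        rw [← Finset.sum_filter_add_sum_filter_not Finset.univ (· ∈ S),
          Finset.sum_eq_zero (s := Finset.univ.filter (¬ · ∈ S)) (by simp +contextual), add_zero,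
          Finset.filter_univ_mem]
        exact Finset.sum_congr rfl fun e he => by rw [if_pos he]; ring
    _ ≤ ∑ S, μ S * ∑ e ∈ M, I.w e * I.p e := by
        refine Finset.sum_le_sum fun S _ => ?_
        rcases (h.nonneg S).eq_or_lt with h0 | hS
        · simp [← h0]
        · refine mul_le_mul_of_nonneg_left (hM.2 S fun e he f hf hef => ?_) hS.le
          rintro ⟨v, hev, hfv⟩
          have := h.card_incident_le hG hy (v := v) (k := 1) (by simpa using hdeg v) hS
          exact hef (Finset.card_le_one.1 this e (mem_incident.2 ⟨he, hev⟩) f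
            (mem_incident.2 ⟨hf, hfv⟩))
    _ = ∑ e ∈ M, I.w e * I.p e := by rw [← Finset.sum_mul, h.sum_eq_one, one_mul]

end Graph

/-! ### The law of the random order -/

/-- The density of `orderLaw q`. -/
noncomputable def orderDensity (q y : ℝ) : ℝ :=
  if 0 ≤ y ∧ 1 - q ≤ Real.exp (-(q * y)) then Real.exp (-(q * y)) else 0

theorem orderLaw_eq (q : ℝ) :
    orderLaw q = volume.withDensity fun y => ENNReal.ofReal (orderDensity q y) := rfl

theorem orderDensity_nonneg (q y : ℝ) : 0 ≤ orderDensity q y := by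
  unfold orderDensity
  split_ifs <;> positivity

theorem orderDensity_le {q : ℝ} (y : ℝ) :
    orderDensity q y ≤ Set.indicator (Set.Ici 0) (fun y => Real.exp (-(q * y))) y := by
  unfold orderDensity
  by_cases hy : 0 ≤ y
  · rw [Set.indicator_of_mem (by exact hy)]
    split_ifs
    · exact le_rfl
    · positivity
  · simp [hy]

theorem measurable_orderDensity (q : ℝ) : Measurable (orderDensity q) := by
  have hexp : Measurable fun y : ℝ => Real.exp (-(q * y)) := by fun_prop
  refine Measurable.ite ?_ hexp measurable_const
  exact (measurableSet_le measurable_const measurable_id).inter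
    (measurableSet_le measurable_const hexp)

theorem integral_orderLaw (q : ℝ) (f : ℝ → ℝ) :
    ∫ y, f y ∂(orderLaw q) = ∫ y, orderDensity q y * f y := by
  rw [orderLaw_eq, integral_withDensity_eq_integral_toReal_smul
    (measurable_orderDensity q).ennreal_ofReal (by simp)]
  simp [ENNReal.toReal_ofReal (orderDensity_nonneg _ _)]

theorem integral_Icc_exp_neg_mul {k m : ℝ} (hk : k ≠ 0) (hm : 0 ≤ m) :
    ∫ y in Set.Icc 0 m, Real.exp (-(k * y)) = (1 - Real.exp (-(k * m))) / k := by
  rw [integral_Icc_eq_integral_Ioc, ← intervalIntegral.integral_of_le hm]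
  have h : ∀ y ∈ Set.uIcc 0 m, HasDerivAt (fun y => -Real.exp (-(k * y)) / k)
      (Real.exp (-(k * y))) y := by
    intro y _
    have h := (((hasDerivAt_id y).const_mul k).neg.exp).neg.div_const k
    refine HasDerivAt.congr_deriv (f := fun y => -Real.exp (-(k * y)) / k) h ?_
    simp only [Pi.neg_apply, id, mul_one]
    field_simp
  rw [intervalIntegral.integral_eq_sub_of_hasDerivAt h
    (by apply Continuous.intervalIntegrable; fun_prop)]
  simp
  ring

theorem integral_Ici_exp_neg_mul {k : ℝ} (hk : 0 < k) :
    ∫ y in Set.Ici 0, Real.exp (-(k * y)) = 1 / k := by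
  rw [integral_Ici_eq_integral_Ioi]
  simpa [neg_mul, neg_div_neg_eq] using integral_exp_mul_Ioi (neg_neg_of_pos hk) 0

theorem integrableOn_exp_neg_mul {k : ℝ} (hk : 0 < k) :
    IntegrableOn (fun y => Real.exp (-(k * y))) (Set.Ici 0) := by
  rw [integrableOn_Ici_iff_integrableOn_Ioi]
  simpa [neg_mul] using integrableOn_exp_mul_Ioi (neg_neg_of_pos hk) 0

theorem integrable_orderDensity {q : ℝ} (hq : 0 < q) : Integrable (orderDensity q) := by
  refine Integrable.mono' ((integrableOn_exp_neg_mul hq).integrable_indicator measurableSet_Ici)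
    (measurable_orderDensity q).aestronglyMeasurable (.of_forall fun y => ?_)
  rw [Real.norm_of_nonneg (orderDensity_nonneg _ _)]
  exact orderDensity_le y

theorem orderDensity_eq_indicator {q : ℝ} (hq : 0 < q) (hq1 : q < 1) :
    orderDensity q = Set.indicator (Set.Icc 0 (1 / q * Real.log (1 / (1 - q))))
      (fun y => Real.exp (-(q * y))) := by
  funext y
  have h : 1 - q ≤ Real.exp (-(q * y)) ↔ y ≤ 1 / q * Real.log (1 / (1 - q)) := by
    rw [← Real.log_le_iff_le_exp (by linarith), one_div (1 - q), Real.log_inv, one_div,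
      le_inv_mul_iff₀ hq]
    constructor <;> intro h <;> linarith
  simp only [orderDensity, h, Set.indicator, Set.mem_Icc]

theorem orderDensity_one :
    orderDensity 1 = Set.indicator (Set.Ici 0) (fun y => Real.exp (-(1 * y))) := by
  funext y
  simp [orderDensity, Set.indicator, Real.exp_nonneg]

theorem upperEnd_nonneg {q : ℝ} (hq : 0 < q) (hq1 : q < 1) :
    0 ≤ 1 / q * Real.log (1 / (1 - q)) := by
  refine mul_nonneg (by positivity) (Real.log_nonneg ?_)
  rw [le_div_iff₀ (by linarith)]
  linarith

/-- The exponential moments of `orderLaw q`; those with `c = 0` and `c = 2` are needed. -/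
theorem integral_orderDensity_mul_exp {q : ℝ} (hq : 0 < q) (hq1 : q < 1) {c : ℝ} (hc : 0 ≤ c) :
    ∫ y, orderDensity q y * Real.exp (-(c * y)) =
      (1 - Real.exp (-((c + q) * (1 / q * Real.log (1 / (1 - q)))))) / (c + q) := by
  rw [← integral_Icc_exp_neg_mul (by positivity) (upperEnd_nonneg hq hq1),
    ← integral_indicator measurableSet_Icc]
  congr 1
  funext y
  rw [orderDensity_eq_indicator hq hq1]
  simp only [Set.indicator]
  split_ifs
  · rw [← Real.exp_add]; ring_nf
  · simp

theorem integral_orderDensity_one_mul_exp {c : ℝ} (hc : 0 ≤ c) :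
    ∫ y, orderDensity 1 y * Real.exp (-(c * y)) = 1 / (c + 1) := by
  rw [← integral_Ici_exp_neg_mul (by positivity), ← integral_indicator measurableSet_Ici]
  congr 1
  funext y
  rw [orderDensity_one]
  simp only [Set.indicator]
  split_ifs
  · rw [← Real.exp_add]; ring_nf
  · simp

theorem integral_orderDensity {q : ℝ} (hq : 0 < q) (hq1 : q ≤ 1) :
    ∫ y, orderDensity q y = 1 := by
  rcases hq1.lt_or_eq with h | rfl
  · have := integral_orderDensity_mul_exp hq h le_rfl
    simp only [zero_mul, neg_zero, Real.exp_zero, mul_one, zero_add] at this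
    rw [this, ← mul_assoc, mul_one_div_cancel hq.ne', one_mul, one_div, Real.log_inv, neg_neg,
      Real.exp_log (by linarith)]
    field_simp
    ring
  · simpa using integral_orderDensity_one_mul_exp le_rfl

theorem isProbabilityMeasure_orderLaw {q : ℝ} (hq : 0 < q) (hq1 : q ≤ 1) :
    IsProbabilityMeasure (orderLaw q) := by
  constructor
  rw [orderLaw_eq, withDensity_apply _ MeasurableSet.univ, Measure.restrict_univ,
    ← ofReal_integral_eq_lintegral_ofReal (integrable_orderDensity hq)
      (.of_forall fun y => orderDensity_nonneg q y), integral_orderDensity hq hq1,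
    ENNReal.ofReal_one]

theorem integrable_orderDensity_mul {q : ℝ} (hq : 0 < q) {c : ℝ} (hc : 0 ≤ c) :
    Integrable fun y => orderDensity q y * Real.exp (-(c * y)) := by
  refine (integrable_orderDensity hq).mono
    ((measurable_orderDensity q).mul (by fun_prop)).aestronglyMeasurable (.of_forall fun y => ?_)
  rw [norm_mul, Real.norm_of_nonneg (Real.exp_nonneg _)]
  by_cases hy : 0 ≤ y
  · refine mul_le_of_le_one_right (norm_nonneg _) (Real.exp_le_one_iff.2 ?_)
    have := mul_nonneg hc hy
    linarith
  · simp [orderDensity, hy]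

theorem ae_nonneg_orderLaw (q : ℝ) : ∀ᵐ y ∂(orderLaw q), 0 ≤ y := by
  rw [orderLaw_eq, ae_withDensity_iff (measurable_orderDensity q).ennreal_ofReal]
  refine .of_forall fun y hy => ?_
  by_contra h
  simp [orderDensity, h] at hy

/-- With probability at least `exp (-(q * y))`, an edge of probability `q` is absent or comes after
time `y`; here the presence of the edge has been averaged out. -/
theorem exp_neg_le_integral_orderLaw {q : ℝ} (hq : 0 < q) (hq1 : q ≤ 1) {y : ℝ} (hy : 0 ≤ y) :
    Real.exp (-(q * y)) ≤ ∫ z, (if z ≤ y then 1 - q else 1) ∂(orderLaw q) := by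
  have hind : ∀ z, orderDensity q z * (if z ≤ y then 1 - q else 1) =
      orderDensity q z - q * Set.indicator (Set.Iic y) (orderDensity q) z := by
    intro z
    by_cases hz : z ≤ y
    · simp [hz]; ring
    · simp [hz]
  have hint := integrable_orderDensity hq
  simp only [integral_orderLaw, hind]
  rw [integral_sub hint ((hint.indicator measurableSet_Iic).const_mul q),
    integral_orderDensity hq hq1, integral_const_mul]
  have hle : ∫ z, Set.indicator (Set.Iic y) (orderDensity q) z ≤
      (1 - Real.exp (-(q * y))) / q := by
    rw [← integral_Icc_exp_neg_mul hq.ne' hy, ← integral_indicator measurableSet_Icc]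
    refine integral_mono (hint.indicator measurableSet_Iic)
      (((integrableOn_exp_neg_mul hq).mono_set Set.Icc_subset_Ici_self).integrable_indicator
        measurableSet_Icc) fun z => ?_
    have h := orderDensity_le (q := q) z
    simp only [Set.indicator, Set.mem_Iic, Set.mem_Icc, Set.mem_Ici] at h ⊢
    split_ifs at h ⊢ <;> grind
  rw [le_div_iff₀ hq] at hle
  linarith

/-! ### The function `g` -/

/-- `g q` is the Laplace transform of `orderLaw q` at `2`. -/
theorem g_eq_integral {q : ℝ} (hq : 0 < q) (hq1 : q ≤ 1) :
    g q = ∫ y, orderDensity q y * Real.exp (-(2 * y)) := by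
  rcases hq1.lt_or_eq with h | rfl
  · rw [integral_orderDensity_mul_exp hq h two_pos.le, g, if_neg h.ne]
    ring
  · rw [integral_orderDensity_one_mul_exp two_pos.le, g, if_pos rfl]
    norm_num

/-- The two densities cross once: the one for `p` is the larger one up to the end of its support.
Hence `orderLaw p` gives more weight to small arguments than `orderLaw q`. -/
theorem g_anti {p q : ℝ} (hp : 0 < p) (hpq : p ≤ q) (hq1 : q ≤ 1) : g q ≤ g p := by
  rcases hpq.eq_or_lt with rfl | hlt
  · exact le_rfl
  have hp1 : p < 1 := hlt.trans_le hq1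
  have hq : 0 < q := hp.trans hlt
  rw [g_eq_integral hp hp1.le, g_eq_integral hq hq1]
  set m := 1 / p * Real.log (1 / (1 - p)) with hm
  have ip := integrable_orderDensity hp
  have iq := integrable_orderDensity hq
  have ip2 := integrable_orderDensity_mul hp two_pos.le
  have iq2 := integrable_orderDensity_mul hq two_pos.le
  have hpos : 0 ≤ ∫ y, (orderDensity p y * Real.exp (-(2 * y)) -
      orderDensity q y * Real.exp (-(2 * y)) -
      Real.exp (-(2 * m)) * (orderDensity p y - orderDensity q y)) := by
    refine integral_nonneg fun y => ?_
    have heq : orderDensity p y * Real.exp (-(2 * y)) - orderDensity q y * Real.exp (-(2 * y)) -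
        Real.exp (-(2 * m)) * (orderDensity p y - orderDensity q y) =
        (Real.exp (-(2 * y)) - Real.exp (-(2 * m))) * (orderDensity p y - orderDensity q y) := by
      ring
    rw [Pi.zero_apply, heq]
    by_cases hy0 : 0 ≤ y
    · have hdp : orderDensity p y = if y ≤ m then Real.exp (-(p * y)) else 0 := by
        rw [orderDensity_eq_indicator hp hp1, ← hm]
        simp [Set.indicator, hy0]
      by_cases hy : y ≤ m
      · refine mul_nonneg (sub_nonneg.2 (Real.exp_le_exp.2 (by linarith))) (sub_nonneg.2 ?_)
        rw [hdp, if_pos hy]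
        refine (orderDensity_le y).trans ?_
        rw [Set.indicator_of_mem (by exact hy0)]
        exact Real.exp_le_exp.2 (by nlinarith)
      · rw [hdp, if_neg hy]
        refine mul_nonneg_of_nonpos_of_nonpos
          (sub_nonpos.2 (Real.exp_le_exp.2 (by linarith [not_le.1 hy]))) ?_
        linarith [orderDensity_nonneg q y]
    · simp [orderDensity, hy0]
  have isub : Integrable fun y => orderDensity p y - orderDensity q y := ip.sub iq
  have isub2 : Integrable fun y => orderDensity p y * Real.exp (-(2 * y)) -
      orderDensity q y * Real.exp (-(2 * y)) := ip2.sub iq2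
  rw [integral_sub isub2 (isub.const_mul _), integral_sub ip2 iq2,
    integral_const_mul, integral_sub ip iq, integral_orderDensity hp hp1.le,
    integral_orderDensity hq hq1] at hpos
  linarith

theorem g_threshold_ge : 0.37698 ≤ g threshold := by
  have hexp : Real.exp (-((2 + threshold) * (1 / threshold * Real.log (1 / (1 - threshold))))) ≤
      0.019 := by
    have hlog : Real.log (0.3978 : ℝ) < 0 := Real.log_neg (by norm_num) (by norm_num)
    -- The exponent is `4.32… * log 0.3978`, and `4.3 = 43 / 10` is a rational bound good enough.
    calc Real.exp (-((2 + threshold) * (1 / threshold * Real.log (1 / (1 - threshold)))))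
        ≤ Real.exp (43 / 10 * Real.log 0.3978) := by
          apply Real.exp_le_exp.2
          have : (1 : ℝ) - threshold = 0.3978 := by norm_num [threshold]
          rw [this, one_div (0.3978 : ℝ), Real.log_inv]
          norm_num [threshold] at hlog ⊢
          linarith
      _ ≤ 0.019 := by
          rw [mul_comm, Real.exp_mul, Real.exp_log (by norm_num)]
          refine le_of_pow_le_pow_left₀ (n := 10) (by norm_num) (by norm_num) ?_
          rw [← Real.rpow_natCast, ← Real.rpow_mul (by norm_num)]
          norm_num
  rw [g, if_neg (by norm_num [threshold])]
  have h2 : (0 : ℝ) < 1 / (2 + threshold) := by norm_num [threshold]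
  refine le_trans ?_ (mul_le_mul_of_nonneg_left (sub_le_sub_left hexp 1) h2.le)
  norm_num [threshold]

/-- The worst case is the fraction `γ` for which both bounds are equal; there they are about
`0.35156`, while `1 / 2.845` is about `0.35149`. -/
theorem inv_le_max_bound {γ : ℝ} (h1 : γ ≤ 1) :
    1 / 2.845 ≤ max (γ * threshold) (γ / 3 + g threshold * (1 - γ)) := by
  have hg := mul_le_mul_of_nonneg_right g_threshold_ge (sub_nonneg.2 h1)
  rw [le_max_iff]
  by_contra! h
  norm_num [threshold] at h hg
  linarith [h.1, h.2]

section Graph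

variable {V : Type*} [Fintype V] [DecidableEq V] {G : SimpleGraph V} [DecidableRel G.Adj]

/-! ### Probing in the random order -/

theorem perm_sortedBy (Y : G.edgeSet → ℝ) (S : Finset G.edgeSet) :
    (sortedBy Y S).Perm S.toList := List.perm_insertionSort _ _

theorem nodup_sortedBy (Y : G.edgeSet → ℝ) (S : Finset G.edgeSet) : (sortedBy Y S).Nodup :=
  (perm_sortedBy Y S).nodup_iff.2 S.nodup_toList

theorem mem_sortedBy {Y : G.edgeSet → ℝ} {S : Finset G.edgeSet} {e : G.edgeSet} :
    e ∈ sortedBy Y S ↔ e ∈ S := by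
  rw [(perm_sortedBy Y S).mem_iff, Finset.mem_toList]

theorem toFinset_sortedBy (Y : G.edgeSet → ℝ) (S : Finset G.edgeSet) :
    (sortedBy Y S).toFinset = S := by
  ext e; simp [mem_sortedBy]

theorem pairwise_sortedBy (Y : G.edgeSet → ℝ) (S : Finset G.edgeSet) :
    (sortedBy Y S).Pairwise fun e f => Y e ≤ Y f := by
  have : Std.Total fun e f : G.edgeSet => Y e ≤ Y f := ⟨fun e f => le_total _ _⟩
  have : IsTrans G.edgeSet fun e f => Y e ≤ Y f := ⟨fun _ _ _ => le_trans⟩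
  exact List.pairwise_insertionSort _ _

open scoped Classical in
theorem le_of_mem_takeWhile_sortedBy {Y : G.edgeSet → ℝ} {S : Finset G.edgeSet} {e f : G.edgeSet}
    (he : e ∈ S) (hf : f ∈ (sortedBy Y S).takeWhile fun f => decide (f ≠ e)) : Y f ≤ Y e := by
  have h := pairwise_sortedBy Y S
  rw [← List.takeWhile_append_dropWhile (p := fun f => decide (f ≠ e)) (l := sortedBy Y S),
    List.pairwise_append] at h
  refine h.2.2 f hf e ?_
  have he' := mem_sortedBy (Y := Y).2 he
  rw [← List.takeWhile_append_dropWhile (p := fun f => decide (f ≠ e)) (l := sortedBy Y S),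
    List.mem_append] at he'
  refine he'.resolve_left fun h => ?_
  simpa using List.mem_takeWhile_imp h

/-- The sorted list depends only on the finitely many comparisons between the values. -/
theorem exists_sortedBy_eq (S : Finset G.edgeSet) :
    ∃ ψ : (G.edgeSet × G.edgeSet → Bool) → List G.edgeSet,
      ∀ Y, sortedBy Y S = ψ fun q => decide (Y q.1 ≤ Y q.2) :=
  ⟨fun c => S.toList.insertionSort fun e f => c (e, f) = true, fun Y => by
    simp only [sortedBy, decide_eq_true_eq]⟩

theorem integrable_comp_sortedBy (P : Measure (G.edgeSet → ℝ)) [IsFiniteMeasure P]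
    (S : Finset G.edgeSet) (φ : List G.edgeSet → ℝ) : Integrable (fun Y => φ (sortedBy Y S)) P := by
  obtain ⟨ψ, hψ⟩ := exists_sortedBy_eq S
  have hmeas : Measurable fun (Y : G.edgeSet → ℝ) (q : G.edgeSet × G.edgeSet) =>
      decide (Y q.1 ≤ Y q.2) := by
    refine measurable_pi_lambda _ fun q => ?_
    refine measurable_to_bool ?_
    have : (fun Y : G.edgeSet → ℝ => decide (Y q.1 ≤ Y q.2)) ⁻¹' {true} =
        {Y | Y q.1 ≤ Y q.2} := by
      ext Y; simp
    rw [this]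
    exact measurableSet_le (measurable_pi_apply _) (measurable_pi_apply _)
  have := (Integrable.of_finite (μ := P.map fun (Y : G.edgeSet → ℝ) q =>
    decide (Y q.1 ≤ Y q.2)) (f := fun c => φ (ψ c))).comp_measurable hmeas
  refine this.congr (.of_forall fun Y => ?_)
  simp only [Function.comp, hψ]

open scoped Classical in
/-- The edges of `S` other than `e` which have a common endpoint with `e`. -/
noncomputable def conflicts (S : Finset G.edgeSet) (e : G.edgeSet) : Finset G.edgeSet :=
  S.filter fun f => f ≠ e ∧ Touch e f

theorem mem_conflicts {S : Finset G.edgeSet} {e f : G.edgeSet} :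
    f ∈ conflicts S e ↔ f ∈ S ∧ f ≠ e ∧ Touch e f := by
  simp [conflicts]

/-- The edge `e` is safe if all the earlier edges of `S` which touch it are absent. -/
theorem Input.prod_le_safeProb (I : Input G) {S : Finset G.edgeSet} {e : G.edgeSet} (he : e ∈ S)
    (Y : G.edgeSet → ℝ) :
    ∏ f, (if f ∈ conflicts S e ∧ Y f ≤ Y e then 1 - I.p f else 1) ≤ I.safeProb S Y e := by
  classical
  set l := (sortedBy Y S).takeWhile fun f => decide (f ≠ e) with hl
  have hnodup : l.Nodup := (nodup_sortedBy Y S).sublist (List.takeWhile_sublist _)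
  have hprod : (l.map fun f => if Touch e f then 1 - I.p f else 1).prod =
      ∏ f, if f ∈ l.toFinset then (if Touch e f then 1 - I.p f else 1) else 1 := by
    rw [← List.prod_toFinset _ hnodup, Finset.prod_ite_mem, Finset.univ_inter]
  have hsafe : I.safeProb S Y e = (probeList l ∅).expect I.p ∅
      fun M => if ∃ f ∈ M, Touch e f then 0 else 1 := by
    rw [Input.safeProb, hl]
  rw [hsafe]
  refine le_trans ?_ (I.prod_le_expect_probeList e l ∅ (by simp))
  rw [hprod]
  refine Finset.prod_le_prod (fun f _ => ?_) fun f _ => ?_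
  · have := I.p_le_one f
    split_ifs <;> linarith
  · have := I.p_pos f
    by_cases hfl : f ∈ l.toFinset
    · rw [if_pos hfl]
      rw [List.mem_toFinset] at hfl
      by_cases ht : Touch e f
      · have hfS : f ∈ S := mem_sortedBy.1 ((List.takeWhile_sublist _).subset hfl)
        have hfe : f ≠ e := by simpa using List.mem_takeWhile_imp hfl
        rw [if_pos ht, if_pos ⟨mem_conflicts.2 ⟨hfS, hfe, ht⟩, le_of_mem_takeWhile_sortedBy he hfl⟩]
      · rw [if_neg ht, if_neg fun h => ht (mem_conflicts.1 h.1).2.2]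
    · rw [if_neg hfl]
      split_ifs <;> linarith

theorem Input.integrable_safeProb (I : Input G) (S : Finset G.edgeSet) (e : G.edgeSet) :
    Integrable (fun Y => I.safeProb S Y e) (Measure.pi fun e => orderLaw (I.p e)) := by
  classical
  have : ∀ f, IsProbabilityMeasure (orderLaw (I.p f)) := fun f =>
    isProbabilityMeasure_orderLaw (I.p_pos f) (I.p_le_one f)
  exact integrable_comp_sortedBy _ S fun l =>
    (probeList (l.takeWhile fun f => decide (f ≠ e)) ∅).expect I.p ∅
      fun M => if ∃ f ∈ M, Touch e f then 0 else 1

/-- Given `Y e = y`, the earlier edges of `T` are absent independently of each other, each with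
probability at least `exp (-(p f * y))`. -/
theorem Input.integral_exp_le_integral_prod (I : Input G) (e : G.edgeSet) (T : Finset G.edgeSet)
    (heT : e ∉ T) :
    ∫ y, Real.exp (-((∑ f ∈ T, I.p f) * y)) ∂(orderLaw (I.p e)) ≤
      ∫ Y, ∏ f, (if f ∈ T ∧ Y f ≤ Y e then 1 - I.p f else 1)
        ∂(Measure.pi fun e => orderLaw (I.p e)) := by
  have : ∀ f, IsProbabilityMeasure (orderLaw (I.p f)) := fun f =>
    isProbabilityMeasure_orderLaw (I.p_pos f) (I.p_le_one f)
  let F : ({f : G.edgeSet // f = e} → ℝ) × ({f : G.edgeSet // ¬ f = e} → ℝ) → ℝ := fun z =>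
    ∏ f : {f : G.edgeSet // ¬ f = e}, if (f : G.edgeSet) ∈ T ∧ z.2 f ≤ z.1 ⟨e, rfl⟩
      then 1 - I.p f else 1
  have hfac : ∀ f (P : Prop) [Decidable P], (if P then 1 - I.p f else 1) ∈ Set.Icc (0 : ℝ) 1 := by
    intro f P _
    have := I.p_pos f
    have := I.p_le_one f
    split_ifs <;> constructor <;> linarith
  have hF : ∀ Y : G.edgeSet → ℝ, ∏ f, (if f ∈ T ∧ Y f ≤ Y e then 1 - I.p f else 1) =
      F (MeasurableEquiv.piEquivPiSubtypeProd (fun _ => ℝ) (fun f => f = e) Y) := by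
    intro Y
    rw [← Fintype.prod_subtype_mul_prod_subtype (fun f => f = e)]
    rw [Finset.prod_eq_one, one_mul]
    · rfl
    · rintro ⟨f, rfl⟩ -
      simp [heT]
  have hFmeas : Measurable F := by
    refine Finset.measurable_prod _ fun f _ => ?_
    by_cases hf : (f : G.edgeSet) ∈ T
    · simp only [hf, true_and]
      exact Measurable.ite (measurableSet_le ((measurable_pi_apply f).comp measurable_snd)
        ((measurable_pi_apply _).comp measurable_fst)) measurable_const measurable_const
    · simp [hf]
  have hFint : Integrable F ((Measure.pi fun f : {f : G.edgeSet // f = e} => orderLaw (I.p f)).prod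
      (Measure.pi fun f : {f : G.edgeSet // ¬ f = e} => orderLaw (I.p f))) := by
    refine Integrable.of_bound hFmeas.aestronglyMeasurable 1 (.of_forall fun z => ?_)
    have h0 : 0 ≤ F z := Finset.prod_nonneg fun f _ => (hfac f _).1
    rw [Real.norm_of_nonneg h0]
    exact Finset.prod_le_one (fun f _ => (hfac f _).1) fun f _ => (hfac f _).2
  simp only [hF]
  have hsplit : ∫ Y, F (MeasurableEquiv.piEquivPiSubtypeProd (fun _ => ℝ) (fun f => f = e) Y)
      ∂(Measure.pi fun f => orderLaw (I.p f)) =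
      ∫ z, F z ∂((Measure.pi fun f : {f : G.edgeSet // f = e} => orderLaw (I.p f)).prod
        (Measure.pi fun f : {f : G.edgeSet // ¬ f = e} => orderLaw (I.p f))) := by
    -- `convert` identifies two `Fintype` instances on `{f // f = e}`.
    convert (measurePreserving_piEquivPiSubtypeProd (fun f => orderLaw (I.p f))
      (fun f => f = e)).integral_comp' F
  rw [hsplit, integral_prod _ hFint]
  have heval := measurePreserving_eval (fun f : {f : G.edgeSet // f = e} => orderLaw (I.p f))
    ⟨e, rfl⟩
  have hexp : Measurable fun y => Real.exp (-((∑ f ∈ T, I.p f) * y)) := by fun_prop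
  have hcT : 0 ≤ ∑ f ∈ T, I.p f := Finset.sum_nonneg fun f _ => (I.p_pos f).le
  have hexple : ∀ᵐ y ∂(orderLaw (I.p e)), ‖Real.exp (-((∑ f ∈ T, I.p f) * y))‖ ≤ 1 := by
    filter_upwards [ae_nonneg_orderLaw (I.p e)] with y hy
    rw [Real.norm_of_nonneg (Real.exp_nonneg _)]
    exact Real.exp_le_one_iff.2 (neg_nonpos.2 (mul_nonneg hcT hy))
  conv_lhs => rw [show orderLaw (I.p e) = _ from heval.map_eq.symm]
  rw [integral_map heval.aemeasurable hexp.aestronglyMeasurable]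
  refine integral_mono_ae ?_ hFint.integral_prod_left ?_
  · exact (heval.integrable_comp hexp.aestronglyMeasurable).2
      (Integrable.of_bound hexp.aestronglyMeasurable 1 hexple)
  · filter_upwards [heval.quasiMeasurePreserving.ae (ae_nonneg_orderLaw (I.p e))] with y hy
    have hprod := integral_fintype_prod_eq_prod
      (μ := fun f : {f : G.edgeSet // ¬ f = e} => orderLaw (I.p f))
      (fun (f : {f : G.edgeSet // ¬ f = e}) (t : ℝ) =>
        if (f : G.edgeSet) ∈ T ∧ t ≤ y ⟨e, rfl⟩ then 1 - I.p f else 1)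
    simp only [F]
    rw [hprod, Finset.sum_mul, ← Finset.sum_neg_distrib, Real.exp_sum]
    have hT : ∏ f ∈ T, Real.exp (-(I.p f * Function.eval ⟨e, rfl⟩ y)) =
        ∏ f : {f : G.edgeSet // ¬ f = e}, if (f : G.edgeSet) ∈ T then
          Real.exp (-(I.p f * y ⟨e, rfl⟩)) else 1 := by
      rw [← Finset.univ_inter T, ← Finset.prod_ite_mem,
        ← Fintype.prod_subtype_mul_prod_subtype (fun f => f = e), Finset.prod_eq_one, one_mul]
      · simp
      · rintro ⟨f, rfl⟩ -
        simp [heT]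
    rw [hT]
    refine Finset.prod_le_prod (fun f _ => by split_ifs <;> positivity) fun f _ => ?_
    by_cases hf : (f : G.edgeSet) ∈ T
    · simp only [hf, if_true, true_and]
      exact exp_neg_le_integral_orderLaw (I.p_pos f) (I.p_le_one f) hy
    · simp [hf]

/-! ### Safety of the edges -/

/-- The tangent of the convex function `c ↦ ∫ y, exp (-(c y))` at `c = 2`; averaging it over the
rounded set replaces an application of Jensen's inequality. -/
theorem tangent_le_integral_exp {q : ℝ} (hq : 0 < q) (hq1 : q ≤ 1) {c : ℝ} (hc : 0 ≤ c) :
    g q - (c - 2) * ∫ y, y * Real.exp (-(2 * y)) ∂(orderLaw q) ≤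
      ∫ y, Real.exp (-(c * y)) ∂(orderLaw q) := by
  have := isProbabilityMeasure_orderLaw hq hq1
  have hint : ∀ {c : ℝ}, 0 ≤ c → Integrable (fun y => Real.exp (-(c * y))) (orderLaw q) := by
    intro c hc
    refine Integrable.of_bound (by fun_prop) 1 ?_
    filter_upwards [ae_nonneg_orderLaw q] with y hy
    rw [Real.norm_of_nonneg (Real.exp_nonneg _)]
    exact Real.exp_le_one_iff.2 (neg_nonpos.2 (mul_nonneg hc hy))
  have hint' : Integrable (fun y => y * Real.exp (-(2 * y))) (orderLaw q) := by
    refine Integrable.of_bound (by fun_prop) 1 ?_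
    filter_upwards [ae_nonneg_orderLaw q] with y hy
    rw [Real.norm_of_nonneg (mul_nonneg hy (Real.exp_nonneg _)), Real.exp_neg,
      mul_inv_le_iff₀ (Real.exp_pos _), one_mul]
    linarith [Real.add_one_le_exp (2 * y)]
  rw [g_eq_integral hq hq1, ← integral_orderLaw, ← integral_const_mul,
    ← integral_sub (hint two_pos.le) (hint'.const_mul _)]
  refine integral_mono ((hint two_pos.le).sub (hint'.const_mul _)) (hint hc) fun y => ?_
  have h := Real.add_one_le_exp (-((c - 2) * y))
  have h2 : Real.exp (-(c * y)) = Real.exp (-(2 * y)) * Real.exp (-((c - 2) * y)) := by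
    rw [← Real.exp_add]; ring_nf
  have := mul_le_mul_of_nonneg_left h (Real.exp_nonneg (-(2 * y)))
  simp only
  rw [h2]
  linarith

/-- Both endpoints of `e` see neighbouring edges of total expected load at most `1`. -/
theorem Input.LPFeasible.sum_conflicts_le {I : Input G} {x : G.edgeSet → ℝ} (hx : I.LPFeasible x)
    (e : G.edgeSet) : ∑ f ∈ conflicts Finset.univ e, I.p f * x f ≤ 2 := by
  obtain ⟨⟨u, v⟩, he⟩ := e
  have hnn : ∀ f, 0 ≤ I.p f * x f := fun f => mul_nonneg (I.p_pos f).le (hx.nonneg f)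
  calc ∑ f ∈ conflicts Finset.univ ⟨s(u, v), he⟩, I.p f * x f
      ≤ ∑ f ∈ incident Finset.univ u ∪ incident Finset.univ v, I.p f * x f := by
        refine Finset.sum_le_sum_of_subset_of_nonneg (fun f hf => ?_) fun f _ _ => hnn f
        obtain ⟨-, -, w, hw, hwf⟩ := mem_conflicts.1 hf
        rw [Finset.mem_union, mem_incident, mem_incident]
        rcases Sym2.mem_iff.1 hw with rfl | rfl
        · exact .inl ⟨Finset.mem_univ _, hwf⟩
        · exact .inr ⟨Finset.mem_univ _, hwf⟩
    _ ≤ ∑ f ∈ incident Finset.univ u, I.p f * x f + ∑ f ∈ incident Finset.univ v, I.p f * x f := by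
        rw [← Finset.sum_union_inter]
        exact le_add_of_nonneg_right (Finset.sum_nonneg fun f _ => hnn f)
    _ ≤ 2 := by linarith [hx.matching u, hx.matching v]

/-- An edge of the rounded set is safe with conditional probability at least `g (p e)`; both sides
are multiplied by `x e`, the probability that `e` is in that set. -/
theorem DependentRounding.mul_g_le_mean (hG : G.IsBipartite) {I : Input G} {x : G.edgeSet → ℝ}
    (hx : I.LPFeasible x) {n : ℕ} {μ : Finset G.edgeSet → ℝ} (h : DependentRounding n x μ)
    (e : G.edgeSet) :
    x e * g (I.p e) ≤ I.mean μ fun S Y => if e ∈ S then I.safeProb S Y e else 0 := by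
  have hprob : ∀ f, IsProbabilityMeasure (orderLaw (I.p f)) := fun f =>
    isProbabilityMeasure_orderLaw (I.p_pos f) (I.p_le_one f)
  set K := ∫ y, y * Real.exp (-(2 * y)) ∂(orderLaw (I.p e)) with hK
  have hK0 : 0 ≤ K := by
    refine integral_nonneg_of_ae ?_
    filter_upwards [ae_nonneg_orderLaw (I.p e)] with y hy
    exact mul_nonneg hy (Real.exp_nonneg _)
  have hS : ∀ S, (if e ∈ S then 1 else 0) * (g (I.p e) + 2 * K) - K * ∑ f ∈ conflicts Finset.univ e,
      I.p f * ((if e ∈ S then 1 else 0) * (if f ∈ S then 1 else 0)) ≤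
      ∫ Y, (if e ∈ S then I.safeProb S Y e else 0)
        ∂(Measure.pi fun e => orderLaw (I.p e)) := by
    intro S
    by_cases he : e ∈ S
    · simp only [he, if_true, one_mul]
      have hc : ∑ f ∈ conflicts Finset.univ e, I.p f * (if f ∈ S then 1 else 0) =
          ∑ f ∈ conflicts S e, I.p f := by
        simp only [mul_ite, mul_one, mul_zero]
        rw [← Finset.sum_filter]
        refine Finset.sum_congr ?_ fun _ _ => rfl
        ext f
        simp only [Finset.mem_filter, mem_conflicts, Finset.mem_univ, true_and]
        tauto
      rw [hc]
      have h1 := tangent_le_integral_exp (I.p_pos e) (I.p_le_one e)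
        (Finset.sum_nonneg fun f (_ : f ∈ conflicts S e) => (I.p_pos f).le)
      have h2 := I.integral_exp_le_integral_prod e (conflicts S e)
        fun h => (mem_conflicts.1 h).2.1 rfl
      have h3 : ∫ Y, ∏ f, (if f ∈ conflicts S e ∧ Y f ≤ Y e then 1 - I.p f else 1)
          ∂(Measure.pi fun e => orderLaw (I.p e)) ≤
          ∫ Y, I.safeProb S Y e ∂(Measure.pi fun e => orderLaw (I.p e)) := by
        refine integral_mono_of_nonneg (.of_forall fun Y => Finset.prod_nonneg fun f _ => ?_)
          (I.integrable_safeProb S e) (.of_forall fun Y => I.prod_le_safeProb he Y)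
        have := I.p_le_one f
        split_ifs <;> linarith
      rw [← hK] at h1
      linarith
    · simp [he]
  calc x e * g (I.p e) ≤ x e * (g (I.p e) + 2 * K) -
        K * ∑ f ∈ conflicts Finset.univ e, I.p f * (x e * x f) := by
        have : ∑ f ∈ conflicts Finset.univ e, I.p f * (x e * x f) =
            x e * ∑ f ∈ conflicts Finset.univ e, I.p f * x f := by
          rw [Finset.mul_sum]
          exact Finset.sum_congr rfl fun f _ => by ring
        rw [this]
        have := mul_le_mul_of_nonneg_left (hx.sum_conflicts_le e) (mul_nonneg hK0 (hx.nonneg e))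
        linarith
    _ ≤ x e * (g (I.p e) + 2 * K) - K * ∑ f ∈ conflicts Finset.univ e, I.p f *
          ∑ S, μ S * ((if e ∈ S then 1 else 0) * (if f ∈ S then 1 else 0)) := by
        refine sub_le_sub_left (mul_le_mul_of_nonneg_left (Finset.sum_le_sum fun f hf => ?_) hK0) _
        obtain ⟨-, hfe, ht⟩ := mem_conflicts.1 hf
        exact mul_le_mul_of_nonneg_left (h.sum_mem_mem_le hG hfe.symm ht) (I.p_pos f).le
    _ = ∑ S, μ S * ((if e ∈ S then 1 else 0) * (g (I.p e) + 2 * K) -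
          K * ∑ f ∈ conflicts Finset.univ e,
            I.p f * ((if e ∈ S then 1 else 0) * (if f ∈ S then 1 else 0))) := by
        simp only [mul_sub, Finset.sum_sub_distrib, ← mul_assoc, ← Finset.sum_mul, h.sum_mem]
        congr 1
        simp only [Finset.mul_sum]
        rw [Finset.sum_comm]
        refine Finset.sum_congr rfl fun S _ => Finset.sum_congr rfl fun f _ => by ring
    _ ≤ _ := Finset.sum_le_sum fun S _ => mul_le_mul_of_nonneg_left (hS S) (h.nonneg S)

/-! ### The patched algorithm -/

theorem Input.mean_const (I : Input G) {μ : Finset G.edgeSet → ℝ} (hμ : ∑ S, μ S = 1) (c : ℝ) :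
    I.mean μ (fun _ _ => c) = c := by
  have : ∀ f, IsProbabilityMeasure (orderLaw (I.p f)) := fun f =>
    isProbabilityMeasure_orderLaw (I.p_pos f) (I.p_le_one f)
  simp [Input.mean, ← Finset.sum_mul, hμ]

/-- Linearity of expectation: each edge contributes its profit if it is rounded up, safe and
present. -/
theorem Input.mean_profit_sortedBy (I : Input G) (μ : Finset G.edgeSet → ℝ) :
    I.mean μ (fun S Y => I.profit (probeList (sortedBy Y S) ∅)) =
      ∑ e, I.w e * I.p e * I.mean μ fun S Y => if e ∈ S then I.safeProb S Y e else 0 := by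
  have hprob : ∀ f, IsProbabilityMeasure (orderLaw (I.p f)) := fun f =>
    isProbabilityMeasure_orderLaw (I.p_pos f) (I.p_le_one f)
  have hprofit : ∀ S Y, I.profit (probeList (sortedBy Y S) ∅) =
      ∑ e, I.w e * I.p e * if e ∈ S then I.safeProb S Y e else 0 := by
    intro S Y
    rw [Input.profit, I.expect_probeList_sum (nodup_sortedBy Y S), toFinset_sortedBy,
      Finset.sum_empty, zero_add]
    simp only [mul_ite, mul_zero, Finset.sum_ite_mem, Finset.univ_inter]
    rfl
  have hint : ∀ S e, Integrable (fun Y => I.w e * I.p e * if e ∈ S then I.safeProb S Y e else 0)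
      (Measure.pi fun e => orderLaw (I.p e)) := by
    intro S e
    refine Integrable.const_mul ?_ _
    split_ifs
    · exact I.integrable_safeProb S e
    · exact integrable_zero _ _ _
  simp only [Input.mean, hprofit, Finset.mul_sum]
  rw [Finset.sum_comm]
  refine Finset.sum_congr rfl fun S _ => ?_
  rw [integral_finsetSum _ fun e _ => hint S e, Finset.mul_sum]
  refine Finset.sum_congr rfl fun e _ => ?_
  rw [integral_const_mul]
  ring

open scoped Classical in
theorem Input.LPFeasible.largeFraction_spec {I : Input G} {x : G.edgeSet → ℝ}
    (hx : I.LPFeasible x) : I.largeFraction x ≤ 1 ∧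
      (∑ e with threshold ≤ I.p e, I.w e * I.p e * x e) = I.largeFraction x * I.lpValue x ∧
      (∑ e with ¬ threshold ≤ I.p e, I.w e * I.p e * x e) =
        (1 - I.largeFraction x) * I.lpValue x := by
  have hnn : ∀ e, 0 ≤ I.w e * I.p e * x e := fun e =>
    mul_nonneg (mul_pos (I.w_pos e) (I.p_pos e)).le (hx.nonneg e)
  have hsplit : (∑ e with threshold ≤ I.p e, I.w e * I.p e * x e) +
      (∑ e with ¬ threshold ≤ I.p e, I.w e * I.p e * x e) = I.lpValue x :=
    Finset.sum_filter_add_sum_filter_not _ _ _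
  have h1 : 0 ≤ ∑ e with threshold ≤ I.p e, I.w e * I.p e * x e :=
    Finset.sum_nonneg fun e _ => hnn e
  have h2 : 0 ≤ ∑ e with ¬ threshold ≤ I.p e, I.w e * I.p e * x e :=
    Finset.sum_nonneg fun e _ => hnn e
  have hmul : (∑ e with threshold ≤ I.p e, I.w e * I.p e * x e) =
      I.largeFraction x * I.lpValue x := by
    -- If the LP value is `0`, then so are `largeFraction x`, by `a / 0 = 0`, and the sum.
    by_cases h0 : I.lpValue x = 0
    · rw [h0, mul_zero]; linarith
    · exact (div_mul_cancel₀ _ h0).symm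
  exact ⟨div_le_one_of_le₀ (by linarith) (by linarith), hmul, by linarith⟩

/-- The greedy algorithm collects at least the fractional matching `p e * x e`. -/
theorem Input.IsMaxMatching.le_sum (hG : G.IsBipartite) {I : Input G} {x : G.edgeSet → ℝ}
    (hx : I.LPFeasible x) {M : Finset G.edgeSet} (hM : I.IsMaxMatching M) :
    I.largeFraction x * threshold * I.lpValue x ≤ ∑ e ∈ M, I.w e * I.p e := by
  classical
  have hnn : ∀ e, 0 ≤ I.w e * I.p e * x e := fun e =>
    mul_nonneg (mul_pos (I.w_pos e) (I.p_pos e)).le (hx.nonneg e)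
  obtain ⟨-, hlarge, -⟩ := hx.largeFraction_spec
  calc I.largeFraction x * threshold * I.lpValue x
      = ∑ e with threshold ≤ I.p e, threshold * (I.w e * I.p e * x e) := by
        rw [← Finset.mul_sum, hlarge]; ring
    _ ≤ ∑ e with threshold ≤ I.p e, I.w e * I.p e * (I.p e * x e) := by
        refine Finset.sum_le_sum fun e he => ?_
        have := mul_le_mul_of_nonneg_right (Finset.mem_filter.1 he).2 (hnn e)
        linarith
    _ ≤ ∑ e, I.w e * I.p e * (I.p e * x e) :=
        Finset.sum_le_sum_of_subset_of_nonneg (Finset.filter_subset _ _) fun e _ _ => by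
          have := mul_nonneg (I.p_pos e).le (hnn e)
          linarith
    _ ≤ ∑ e ∈ M, I.w e * I.p e := hM.sum_mul_le hG
        (fun e => ⟨mul_nonneg (I.p_pos e).le (hx.nonneg e),
          mul_le_one₀ (I.p_le_one e) (hx.nonneg e) (hx.le_one e)⟩) hx.matching

/-- Large edges are safe with probability at least `g 1 = 1 / 3`, and small ones with probability
at least `g threshold`. -/
theorem DependentRounding.le_mean_profit (hG : G.IsBipartite) {I : Input G} {x : G.edgeSet → ℝ}
    (hx : I.LPFeasible x) {n : ℕ} {μ : Finset G.edgeSet → ℝ} (h : DependentRounding n x μ) :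
    (I.largeFraction x / 3 + g threshold * (1 - I.largeFraction x)) * I.lpValue x ≤
      I.mean μ fun S Y => I.profit (probeList (sortedBy Y S) ∅) := by
  classical
  have hnn : ∀ e, 0 ≤ I.w e * I.p e * x e := fun e =>
    mul_nonneg (mul_pos (I.w_pos e) (I.p_pos e)).le (hx.nonneg e)
  obtain ⟨-, hlarge, hsmall⟩ := hx.largeFraction_spec
  rw [I.mean_profit_sortedBy]
  calc (I.largeFraction x / 3 + g threshold * (1 - I.largeFraction x)) * I.lpValue x
      = (∑ e with threshold ≤ I.p e, I.w e * I.p e * x e * (1 / 3)) +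
        ∑ e with ¬ threshold ≤ I.p e, I.w e * I.p e * x e * g threshold := by
        rw [← Finset.sum_mul, ← Finset.sum_mul, hlarge, hsmall]; ring
    _ ≤ (∑ e with threshold ≤ I.p e, I.w e * I.p e * x e * g (I.p e)) +
        ∑ e with ¬ threshold ≤ I.p e, I.w e * I.p e * x e * g (I.p e) := by
        refine add_le_add (Finset.sum_le_sum fun e _ => ?_) (Finset.sum_le_sum fun e he => ?_)
        · refine mul_le_mul_of_nonneg_left ?_ (hnn e)
          have := g_anti (I.p_pos e) (I.p_le_one e) le_rfl
          rwa [g, if_pos rfl] at this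
        · exact mul_le_mul_of_nonneg_left (g_anti (I.p_pos e)
            (not_le.1 (Finset.mem_filter.1 he).2).le (by norm_num [threshold])) (hnn e)
    _ = ∑ e, I.w e * I.p e * (x e * g (I.p e)) := by
        rw [Finset.sum_filter_add_sum_filter_not]
        exact Finset.sum_congr rfl fun e _ => by ring
    _ ≤ _ := Finset.sum_le_sum fun e _ => mul_le_mul_of_nonneg_left (h.mul_g_le_mean hG hx e)
        (mul_pos (I.w_pos e) (I.p_pos e)).le

theorem Input.feasible_patched (hG : G.IsBipartite) {I : Input G} {x : G.edgeSet → ℝ}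
    (hx : I.LPFeasible x) {n : ℕ} {μ : Finset G.edgeSet → ℝ} (h : DependentRounding n x μ)
    {L : List G.edgeSet} (hL : L.Nodup) (hM : IsMatching L.toFinset) {S : Finset G.edgeSet}
    (hS : 0 < μ S) (Y : G.edgeSet → ℝ) : I.Feasible (I.patched x L S Y) := by
  unfold Input.patched
  split_ifs
  · exact I.feasible_probeList hL fun v => (hM.card_incident_le_one v).trans (I.t_pos v)
  · refine I.feasible_probeList (nodup_sortedBy Y S) fun v => ?_
    rw [toFinset_sortedBy]
    exact h.card_incident_le hG (fun e => ⟨hx.nonneg e, hx.le_one e⟩) (hx.timeout v) hS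

theorem Input.le_mean_profit_patched (hG : G.IsBipartite) {I : Input G} {x : G.edgeSet → ℝ}
    (hx : I.LPFeasible x) {n : ℕ} {μ : Finset G.edgeSet → ℝ} (h : DependentRounding n x μ)
    {L : List G.edgeSet} (hL : L.Nodup) (hM : I.IsMaxMatching L.toFinset) :
    1 / 2.845 * I.lpValue x ≤ I.mean μ fun S Y => I.profit (I.patched x L S Y) := by
  have hlp : 0 ≤ I.lpValue x := Finset.sum_nonneg fun e _ =>
    mul_nonneg (mul_pos (I.w_pos e) (I.p_pos e)).le (hx.nonneg e)
  have hmax := inv_le_max_bound hx.largeFraction_spec.1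
  by_cases hcond : I.largeFraction x / 3 + g threshold * (1 - I.largeFraction x) ≤
      I.largeFraction x * threshold
  · simp only [Input.patched, if_pos hcond]
    rw [max_eq_left hcond] at hmax
    rw [I.mean_const h.sum_eq_one]
    exact (mul_le_mul_of_nonneg_right hmax hlp).trans
      ((hM.le_sum hG hx).trans (I.sum_le_profit_probeList hL hM.1))
  · simp only [Input.patched, if_neg hcond]
    rw [max_eq_right (not_le.1 hcond).le] at hmax
    exact (mul_le_mul_of_nonneg_right hmax hlp).trans (h.le_mean_profit hG hx)

end Graph

end StochasticMatching

open StochasticMatching in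
theorem theorem1 {V : Type*} [Fintype V] [DecidableEq V] (G : SimpleGraph V)
    [DecidableRel G.Adj] (hG : G.IsBipartite) (I : Input G) :
    -- an optimal strategy exists, and every step of the algorithm can be carried out
    (∃ OPT, I.IsOptimal OPT) ∧
    (∃ x, I.LPOptimal x) ∧
    (∀ x, I.LPOptimal x → ∃ n μ, DependentRounding n x μ) ∧
    (∃ M, I.IsMaxMatching M) ∧
    -- the guarantees, for every way of carrying out the steps
    ∀ (x : G.edgeSet → ℝ), I.LPOptimal x →
    ∀ (n : ℕ) (μ : Finset G.edgeSet → ℝ), DependentRounding n x μ →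
      -- the rounding makes at most as many iterations as there are edges
      n ≤ Fintype.card G.edgeSet ∧
      -- the random order makes every edge safe with probability at least `g (p e)`
      (∀ e, 0 < probMem μ e → g (I.p e) ≤ I.condSafeProb μ e) ∧
      ∀ (L : List G.edgeSet), L.Nodup → I.IsMaxMatching L.toFinset →
        -- the patched algorithm respects the rules for all outcomes of its random choices
        (∀ S, 0 < μ S → ∀ Y, I.Feasible (I.patched x L S Y)) ∧
        -- its expected profit is at least the optimum divided by `2.845`
        (∀ OPT, I.IsOptimal OPT →
          (1 / 2.845) * I.profit OPT ≤ I.mean μ (fun S Y => I.profit (I.patched x L S Y))) := by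
  refine ⟨I.exists_isOptimal, I.exists_lpOptimal,
    fun x hx => exists_dependentRounding fun e => ⟨hx.1.nonneg e, hx.1.le_one e⟩,
    I.exists_isMaxMatching, fun x hx n μ h => ⟨?_, fun e he => ?_, fun L hL hM =>
      ⟨fun S hS Y => Input.feasible_patched hG hx.1 h hL hM.1 hS Y, fun OPT hOPT => ?_⟩⟩⟩
  · exact h.le_card.trans (Finset.card_le_univ _)
  · rw [Input.condSafeProb, le_div_iff₀ he, h.probMem_eq e, mul_comm]
    exact h.mul_g_le_mean hG hx.1 e
  · exact (mul_le_mul_of_nonneg_left (Input.Feasible.profit_le I hOPT.1 hx) (by norm_num)).trans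
      (Input.le_mean_profit_patched hG hx.1 h hL hM)
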